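/- Let $\rho\in\mathbb{R}$, $\sigma,c\in(0,\infty)$ and let $\eta_1$ be a Borel probability measure on $\mathbb{R}$. Let $M(z,\mathrm{d}x)=\mathcal{N}(\rho z,\sigma^2)$, $G(z)=e^{-cz^2/2}$ and $Q(z,\mathrm{d}x)=M(z,\mathrm{d}x)G(x)$ (with $Q^0$ the identity kernel), and let $$\hat\eta_1(\mathrm{d}x)=\frac{G(x)\,\eta_1(\mathrm{d}x)}{\int G\,\mathrm{d}\eta_1},\qquad \hat\eta_t=\frac{\hat\eta_1Q^{t-1}}{\hat\eta_1Q^{t-1}(\mathbb{R})},\qquad \eta_t=\hat\eta_{t-1}M,\qquad t\ge 2,$$ be the filtering and predictive distributions of the state-space model $Y_t=X_t+c^{-1/2}Z_t$, $X_{t+1}=\rho X_t+\sigma W_{t+1}$, $X_1\sim\eta_1$ (with independent $\mathcal{N}(0,1)$ noises $Z_t$, $W_{t+1}$) when all observations are $y_t=0$. For a probability measure $\pi$ on $\mathbb{R}$ let $F_\pi$ be its distribution function, $F_\pi^{-1}(u)=\inf\{x: F_\pi(x)\ge u\}$, and let $\|\pi_1-\pi_2\|=\sup_{a\in\mathbb{R}}|F_{\pi_1}(a)-F_{\pi_2}(a)|$.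 A sequence $(u^n)_{n\ge1}$ in $[0,1)^2$ is a $(0,2)$-sequence in base $2$ if, for all integers $a,m\ge0$, every box $\prod_{j=1}^2[a_j2^{-d_j},(a_j+1)2^{-d_j})$ with integers $d_j\ge0$, $0\le a_j<2^{d_j}$ and $d_1+d_2=m$ contains exactly one of the points $u^n$, $a2^m<n\le(a+1)2^m$. A scrambled $(0,2)$-sequence in base $2$ is a sequence of $(0,1)^2$-valued random variables, each uniformly distributed on $(0,1)^2$, which is almost surely a $(0,2)$-sequence in base $2$. For $N\ge1$ and every $t\ge1$ let $\{U_t^n\}_{n=1}^N$ be the first $N$ points of a scrambled $(0,2)$-sequence in base $2$; these sequences may depend on $N$, are all defined on one probability space, and no independence between different $t$ is assumed. Write $U^n_t=(U^n_{t,1},U^n_{t,2})$. Define $X_1^n=F_{\eta_1}^{-1}(U_{1,1}^n)$ and, for $t\ge2$, $\hat X_{t-1}^n=F^{-1}_{\hat\eta^N_{t-1}}(U_{t,1}^n)$ and $X_t^n=F^{-1}_{M(\hat X_{t-1}^n,\cdot)}(U_{t,2}^n)$, where for all $t\ge1$ $$\eta_t^N=\frac1N\sum_{n=1}^N\delta_{X_t^n},\qquad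 \hat\eta_t^N=\sum_{n=1}^NW_t^n\delta_{X_t^n},\qquad W_t^n=\frac{G(X_t^n)}{\sum_{m=1}^NG(X_t^m)}.$$ Let $$\delta_N=\begin{cases}\dfrac{\log(N)+3}{2N},&N\in\{2^k:k\in\{0,1,2,\dots\}\},\\[2mm]\dfrac{\log(N)^2+11\log(2)\log(N)+18\log(2)^2}{8N\log(2)^2},&\text{otherwise.}\end{cases}$$ Then there is a constant $\bar C_2\in(0,\infty)$, depending only on $\rho,\sigma,c,\eta_1$ (in particular not on $N$), such that for every $N\ge1$, almost surely, $$\max\Big\{\sup_{t\ge1}\|\hat\eta_t^N-\hat\eta_t\|,\ \sup_{t\ge1}\|\eta_t^N-\eta_t\|\Big\}\le\bar C_2\,\delta_N^{1/2}\log\big(1+\delta_N^{-1/2}\big).$$ Consequently, almost surely, $\lim_{N\to\infty}\sup_{t\ge1}\|\hat\eta_t^N-\hat\eta_t\|=\lim_{N\to\infty}\sup_{t\ge1}\|\eta_t^N-\eta_t\|=0$. -/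

import Mathlib

open MeasureTheory ProbabilityTheory Filter Topology
open scoped ENNReal NNReal

namespace SQMC

noncomputable section

/-! ### Digital nets, `(t,s)`-sequences and scrambled sequences -/

/-- The `b`-ary box `∏ⱼ [aⱼ b^{-dⱼ}, (aⱼ+1) b^{-dⱼ})` in dimension `s`. -/
def baryBox (b : ℕ) {s : ℕ} (a d : Fin s → ℕ) : Set (Fin s → ℝ) :=
  Set.pi Set.univ fun j =>
    Set.Ico ((a j : ℝ) / (b : ℝ) ^ d j) (((a j : ℝ) + 1) / (b : ℝ) ^ d j)

open Classical in
/-- The finite family `(u n)_{n ∈ I}` of points of `[0,1)^s` is a `(t,m,s)`-net in base `b`: it has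
`b^m` members and every `b`-ary box of volume `b^{t-m}`, i.e. with `∑ⱼ dⱼ = m - t`, contains
exactly `b^t` of them (counted with multiplicity). -/
def IsNet (t m b : ℕ) {s : ℕ} (I : Finset ℕ) (u : ℕ → Fin s → ℝ) : Prop :=
  t ≤ m ∧ I.card = b ^ m ∧ (∀ n ∈ I, ∀ j, u n j ∈ Set.Ico (0 : ℝ) 1) ∧
    ∀ a d : Fin s → ℕ, (∀ j, a j < b ^ d j) → (∑ j, d j) + t = m →
      (I.filter fun n => u n ∈ baryBox b a d).card = b ^ t

/-- `(u n)_{n ≥ 1}` is a `(t,s)`-sequence in base `b` (the value `u 0` plays no role): for all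
`a ≥ 0` and `m ≥ t` the block `n = a b^m + 1, …, (a+1) b^m` is a `(t,m,s)`-net in base `b`. -/
def IsDigitalSequence (t b : ℕ) {s : ℕ} (u : ℕ → Fin s → ℝ) : Prop :=
  ∀ a m : ℕ, t ≤ m → IsNet t m b (Finset.Icc (a * b ^ m + 1) ((a + 1) * b ^ m)) u

/-- `(U n)_{n ≥ 1}` is a scrambled `(t,s)`-sequence in base `b`: the `U n` are `(0,1)^s`-valued
random variables, each uniform on `(0,1)^s`, and almost surely form a `(t,s)`-sequence in
base `b`. -/
structure IsScrambledSequence {Ω : Type*} [MeasurableSpace Ω] (P : Measure Ω) (t b : ℕ) {s : ℕ}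
    (U : ℕ → Ω → Fin s → ℝ) : Prop where
  measurable : ∀ n, 1 ≤ n → Measurable (U n)
  mem_Ioo : ∀ n, 1 ≤ n → ∀ ω j, U n ω j ∈ Set.Ioo (0 : ℝ) 1
  uniform : ∀ n, 1 ≤ n →
    P.map (U n) = volume.restrict (Set.pi Set.univ fun _ : Fin s => Set.Ioo (0 : ℝ) 1)
  isDigitalSequence : ∀ᵐ ω ∂P, IsDigitalSequence t b fun n => U n ω

open Classical in
/-- The explicit quantity `δ_N`. -/
def delta (N : ℕ) : ℝ :=
  if ∃ k : ℕ, N = 2 ^ k then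
    (Real.log N + 3) / (2 * N)
  else
    (Real.log N ^ 2 + 11 * Real.log 2 * Real.log N + 18 * Real.log 2 ^ 2) /
      (N * 8 * Real.log 2 ^ 2)

/-! ### Distribution functions -/

/-- The Kolmogorov distance `sup_a |F_μ(a) - F_ν(a)|`, as an extended nonnegative real. -/
def kolmogorovDist (μ ν : Measure ℝ) : ℝ≥0∞ :=
  ⨆ a : ℝ, ENNReal.ofReal |cdf μ a - cdf ν a|

/-- The generalized inverse `F_μ⁻¹(u) = inf {x | u ≤ F_μ(x)}` of the distribution function
(used for `0 < u < 1`). -/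
def quantile (μ : Measure ℝ) (u : ℝ) : ℝ :=
  sInf {x : ℝ | u ≤ cdf μ x}

/-! ### The state-space model with all observations equal to zero -/

/-- `G(z) = exp(-c z² / 2)`. -/
def potential (c z : ℝ) : ℝ := Real.exp (-(c * z ^ 2) / 2)

/-- The Markov kernel `M(z, dx) = 𝒩(ρ z, σ²)`. -/
def mutation (ρ σ : ℝ) : Kernel ℝ ℝ where
  toFun z := gaussianReal (ρ * z) (Real.toNNReal (σ ^ 2))
  measurable' :=
    measurable_gaussianReal.comp ((measurable_const.mul measurable_id).prodMk measurable_const)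

instance isMarkovKernel_mutation (ρ σ : ℝ) : IsMarkovKernel (mutation ρ σ) :=
  ⟨fun z => inferInstanceAs (IsProbabilityMeasure (gaussianReal (ρ * z) (Real.toNNReal (σ ^ 2))))⟩

/-- The unnormalized kernel `Q(z, dx) = M(z, dx) G(x)`. -/
def unnormalizedKernel (ρ σ c : ℝ) : Kernel ℝ ℝ :=
  (mutation ρ σ).withDensity fun _ x => ENNReal.ofReal (potential c x)

/-- `η̂₁(dx) = G(x) η₁(dx) / η₁(G)`. -/
def filtering₁ (c : ℝ) (η₁ : Measure ℝ) : Measure ℝ :=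
  (∫⁻ x, ENNReal.ofReal (potential c x) ∂η₁)⁻¹ •
    η₁.withDensity fun x => ENNReal.ofReal (potential c x)

/-- The filtering distribution `η̂_t = η̂₁ Q^{t-1} / (η̂₁ Q^{t-1})(ℝ)` for `t ≥ 1`. For `t = 1`
this is `η̂₁`, the power `Q^0` being the identity kernel. -/
def filtering (ρ σ c : ℝ) (η₁ : Measure ℝ) (t : ℕ) : Measure ℝ :=
  (((filtering₁ c η₁).bind (unnormalizedKernel ρ σ c ^ (t - 1))) Set.univ)⁻¹ •
    (filtering₁ c η₁).bind (unnormalizedKernel ρ σ c ^ (t - 1))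

/-- The predictive distribution `η_t`, `t ≥ 1`: the initial distribution for `t = 1` and
`η̂_{t-1} M` for `t ≥ 2` (the value at `t = 0` plays no role). -/
def predictive (ρ σ c : ℝ) (η₁ : Measure ℝ) (t : ℕ) : Measure ℝ :=
  if t ≤ 1 then η₁ else (filtering ρ σ c η₁ (t - 1)).bind (mutation ρ σ)

/-! ### The particle algorithm -/

/-- `(1/N) ∑_{n=1}^N δ_{X n}`. -/
def empirical (N : ℕ) (X : ℕ → ℝ) : Measure ℝ :=
  (N : ℝ≥0∞)⁻¹ • ∑ n ∈ Finset.Icc 1 N, Measure.dirac (X n)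

/-- `∑_{n=1}^N W n • δ_{X n}` with `W n = G(X n) / ∑_{m=1}^N G(X m)`. -/
def weighted (c : ℝ) (N : ℕ) (X : ℕ → ℝ) : Measure ℝ :=
  ∑ n ∈ Finset.Icc 1 N,
    ENNReal.ofReal (potential c (X n) / ∑ m ∈ Finset.Icc 1 N, potential c (X m)) •
      Measure.dirac (X n)

/-- The particles `X_t^n` (`t ≥ 1`, `1 ≤ n ≤ N`) produced by the algorithm from the points
`u t n = (u t n 0, u t n 1)` of `(0,1)²`: `X_1^n = F_{η₁}⁻¹(u_{1,1}^n)` and, for `t ≥ 2`,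
`X_t^n = F⁻¹_{M(x, ·)}(u_{t,2}^n)` with `x = F⁻¹_{η̂^N_{t-1}}(u_{t,1}^n)` (resampling followed by
mutation). The value at `t = 0` plays no role. -/
def particles (ρ σ c : ℝ) (η₁ : Measure ℝ) (N : ℕ) (u : ℕ → ℕ → Fin 2 → ℝ) : ℕ → ℕ → ℝ
  | 0 => fun _ => 0
  | 1 => fun n => quantile η₁ (u 1 n 0)
  | t + 2 => fun n =>
      quantile
        (mutation ρ σ (quantile (weighted c N (particles ρ σ c η₁ N u (t + 1))) (u (t + 2) n 0)))
        (u (t + 2) n 1)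

/-- The estimate `η̂_t^N` of the filtering distribution at time `t ≥ 1`. -/
def filteringEst (ρ σ c : ℝ) (η₁ : Measure ℝ) (N : ℕ) (u : ℕ → ℕ → Fin 2 → ℝ) (t : ℕ) :
    Measure ℝ :=
  weighted c N (particles ρ σ c η₁ N u t)

/-- The estimate `η_t^N` of the predictive distribution at time `t ≥ 1`. -/
def predictiveEst (ρ σ c : ℝ) (η₁ : Measure ℝ) (N : ℕ) (u : ℕ → ℕ → Fin 2 → ℝ) (t : ℕ) :
    Measure ℝ :=
  empirical N (particles ρ σ c η₁ N u t)

/-- `sup_{t ≥ 1} ‖η̂_t^N - η̂_t‖` for the algorithm run with the points `u t n`. -/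
def filteringError (ρ σ c : ℝ) (η₁ : Measure ℝ) (N : ℕ) (u : ℕ → ℕ → Fin 2 → ℝ) : ℝ≥0∞ :=
  ⨆ t : ℕ, ⨆ _ : 1 ≤ t,
    kolmogorovDist (filteringEst ρ σ c η₁ N u t) (filtering ρ σ c η₁ t)

/-- `sup_{t ≥ 1} ‖η_t^N - η_t‖` for the algorithm run with the points `u t n`. -/
def predictiveError (ρ σ c : ℝ) (η₁ : Measure ℝ) (N : ℕ) (u : ℕ → ℕ → Fin 2 → ℝ) : ℝ≥0∞ :=
  ⨆ t : ℕ, ⨆ _ : 1 ≤ t,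
    kolmogorovDist (predictiveEst ρ σ c η₁ N u t) (predictive ρ σ c η₁ t)

end

end SQMC

/-!
The argument is deterministic: it produces a constant `C` such that, for *every* choice of
`(0,2)`-sequences in the open unit square, both errors are at most `C / √N` uniformly in time. This
is stronger than the stated rate, since `δ_N ≥ 1 / N` and `x log(1 + 1/x) ≥ x / (1 + x)`
(`inv_le_delta`, `inv_sqrt_le_rate`); the almost sure statements follow because only countably many
sequences are involved.

*Local errors.* A particle produced by inversion lies below `a` exactly when its driving point
`(u₁, u₂)` satisfies `u₂ ≤ ψ(u₁)`, where `ψ` is monotone: `ψ(u₁)` is the mass given to `(-∞, a]` by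
the mutation kernel started from the quantile of the weighted particles at level `u₁`. A monotone
graph crosses at most `K + L` cells of a `K × L` grid, and in a net of `K L` points every cell
contains one point, so a block of `2^m` points estimates the area below the graph with an error
`O(2^{m/2})` in the count. Decomposing `{1, …, N}` along the binary digits of `N` gives a geometric
series, hence `O(√N)` in the count for all `N` (`IsDigitalSequence.abs_card_filter_sub_le`). So one
step of the algorithm differs from one step of the exact filter, applied to the current particles,
by at most `12 / √N` in Kolmogorov distance.

*Stability.* Gaussian conjugacy gives the `k`-step filter in closed form (`multiStep`,
`multiStep_predictStep`): reweight the initial law by `exp(-a_k x² / 2)`, then average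
`𝒩(r_k x, v_k)`. The precisions `a_k` obey a Riccati recursion, which makes the product of the
squared gain factors telescope, so `r_k` decays geometrically for every `ρ`
(`exists_stepGain_sq_le`). As the test functions involved are smooth in `x` with total variation of
order `|r_k|`, a Kolmogorov perturbation `E` of the initial law is felt as `O(|r_k| E)` after `k`
steps (`exists_abs_multiStep_sub_le`), provided the laws give a fixed amount of mass to a
neighbourhood of the origin. Summing over the times at which local errors are made yields `O(E)`,
uniformly in time. The mass condition holds for the exact laws
(`exists_le_integral_potential_iterate`), and is passed on to the approximations by induction on
time, because they are `O(E)`-close to the exact laws (`exists_abs_cdf_sub_iterate_le`).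
-/

namespace SQMC

/-! ### Gaussian integrals -/

lemma potential_pos (a x : ℝ) : 0 < potential a x := Real.exp_pos _

lemma potential_le_one {a : ℝ} (ha : 0 ≤ a) (x : ℝ) : potential a x ≤ 1 :=
  Real.exp_le_one_iff.2 (by have := mul_nonneg ha (sq_nonneg x); linarith)

lemma potential_add (a b x : ℝ) : potential (a + b) x = potential a x * potential b x := by
  rw [potential, potential, potential, ← Real.exp_add]
  congr 1
  ring

lemma potential_zero (x : ℝ) : potential 0 x = 1 := by simp [potential]

lemma potential_le_potential {a b : ℝ} (h : a ≤ b) (x : ℝ) : potential b x ≤ potential a x :=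
  Real.exp_le_exp.2 (by have := mul_le_mul_of_nonneg_right h (sq_nonneg x); linarith)

lemma potential_mul_right (a t x : ℝ) : potential a (t * x) = potential (a * t ^ 2) x := by
  rw [potential, potential]
  congr 1
  ring

@[fun_prop]
lemma continuous_potential (a : ℝ) : Continuous (potential a) := by
  unfold potential
  fun_prop

@[fun_prop]
lemma measurable_potential (a : ℝ) : Measurable (potential a) :=
  (continuous_potential a).measurable

lemma integrable_of_abs_le {α : Type*} [MeasurableSpace α] {μ : Measure α} [IsFiniteMeasure μ]
    {f : α → ℝ} {B : ℝ} (hf : Measurable f) (hb : ∀ x, |f x| ≤ B) : Integrable f μ :=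
  Integrable.of_bound hf.aestronglyMeasurable B (ae_of_all _ hb)

lemma abs_integral_le_of_abs_le {α : Type*} [MeasurableSpace α] {μ : Measure α}
    [IsProbabilityMeasure μ] {f : α → ℝ} {B : ℝ} (hb : ∀ x, |f x| ≤ B) : |∫ x, f x ∂μ| ≤ B := by
  simpa using norm_integral_le_of_norm_le_const (μ := μ) (f := f) (ae_of_all _ hb)

lemma integrable_potential {a : ℝ} (ha : 0 ≤ a) (μ : Measure ℝ) [IsFiniteMeasure μ] :
    Integrable (potential a) μ :=
  integrable_of_abs_le (B := 1) (by fun_prop) fun x => by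
    rw [abs_of_pos (potential_pos a x)]
    exact potential_le_one ha x

lemma integral_potential_pos {a : ℝ} (ha : 0 ≤ a) (μ : Measure ℝ) [IsProbabilityMeasure μ] :
    0 < ∫ x, potential a x ∂μ :=
  (integral_pos_iff_support_of_nonneg (fun x => (potential_pos a x).le)
    (integrable_potential ha μ)).2 (by
      rw [Function.support_eq_univ fun x => (potential_pos a x).ne', measure_univ]
      exact one_pos)

lemma integral_potential_le_one {a : ℝ} (ha : 0 ≤ a) (μ : Measure ℝ) [IsProbabilityMeasure μ] :
    ∫ x, potential a x ∂μ ≤ 1 := by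
  calc ∫ x, potential a x ∂μ ≤ ∫ _, (1 : ℝ) ∂μ :=
        integral_mono (integrable_potential ha μ) (integrable_const _) (potential_le_one ha)
    _ = 1 := by simp

/-- Conjugacy: tilting a Gaussian law by a Gaussian weight gives a Gaussian law, with an explicit
Gaussian function of the mean as normalization. The case `v = 0` of a Dirac mass is included. -/
lemma integral_potential_mul_gaussianReal {a : ℝ} (ha : 0 ≤ a) (m : ℝ) (v : ℝ≥0) (f : ℝ → ℝ) :
    ∫ y, potential a y * f y ∂gaussianReal m v =
      (√(1 + v * a))⁻¹ * potential (a / (1 + v * a)) m *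
        ∫ y, f y ∂gaussianReal (m / (1 + v * a)) (v / (1 + v * a)).toNNReal := by
  rcases eq_or_ne v 0 with rfl | hv
  · simp
  have hv' : (0 : ℝ) < v := by positivity
  have hD : 0 < 1 + v * a := by positivity
  have hw : 0 < (v : ℝ) / (1 + v * a) := by positivity
  rw [integral_gaussianReal_eq_integral_smul hv,
    integral_gaussianReal_eq_integral_smul (by simpa using hw), ← integral_const_mul]
  congr 1
  ext y
  have key : gaussianPDFReal m v y * potential a y =
      (√(1 + v * a))⁻¹ * potential (a / (1 + v * a)) m *
        gaussianPDFReal (m / (1 + v * a)) (v / (1 + v * a)).toNNReal y := by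
    simp only [gaussianPDFReal, potential, Real.coe_toNNReal _ hw.le]
    have h1 : √(2 * Real.pi * v) = √(1 + v * a) * √(2 * Real.pi * (v / (1 + v * a))) := by
      rw [← Real.sqrt_mul hD.le]
      congr 1
      field_simp
    rw [h1, mul_inv, mul_assoc, ← Real.exp_add, mul_assoc (_)⁻¹ (Real.exp _),
      mul_left_comm (Real.exp _), ← Real.exp_add, mul_assoc]
    congr 3
    field_simp
    ring
  simp only [smul_eq_mul]
  rw [← mul_assoc, key, mul_assoc]

lemma integral_gaussianReal_eq_zero_mean (x : ℝ) (w : ℝ≥0) {f : ℝ → ℝ} (hf : Measurable f) :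
    ∫ z, f z ∂gaussianReal x w = ∫ z, f (x + z) ∂gaussianReal 0 w := by
  rw [← integral_map (φ := fun z => x + z) (by fun_prop) hf.aestronglyMeasurable,
    gaussianReal_map_const_add, zero_add]

lemma measurable_integral_gaussianReal_zero_mean (w : ℝ≥0) {f : ℝ → ℝ} (hf : Measurable f) :
    Measurable fun x => ∫ z, f (x + z) ∂gaussianReal 0 w :=
  (StronglyMeasurable.integral_prod_right' (f := fun p : ℝ × ℝ => f (p.1 + p.2))
    (hf.comp (by fun_prop)).stronglyMeasurable).measurable

/-- Two successive linear Gaussian transitions compose to a linear Gaussian transition. -/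
lemma integral_gaussianReal_comp (r m : ℝ) (v w : ℝ≥0) {f : ℝ → ℝ} {B : ℝ} (hf : Measurable f)
    (hb : ∀ x, |f x| ≤ B) :
    ∫ y, ∫ z, f z ∂gaussianReal (r * y) w ∂gaussianReal m v =
      ∫ z, f z ∂gaussianReal (r * m) (w + .mk (r ^ 2) (sq_nonneg _) * v) := by
  calc ∫ y, ∫ z, f z ∂gaussianReal (r * y) w ∂gaussianReal m v
      = ∫ x, ∫ z, f (x + z) ∂gaussianReal 0 w ∂((gaussianReal m v).map (r * ·)) := by
        rw [integral_map (by fun_prop)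
          (measurable_integral_gaussianReal_zero_mean w hf).aestronglyMeasurable]
        simp_rw [integral_gaussianReal_eq_zero_mean _ w hf]
    _ = ∫ z, f z ∂(((gaussianReal m v).map (r * ·)) ∗ gaussianReal 0 w) := by
        rw [integral_conv (integrable_of_abs_le hf hb)]
    _ = _ := by
        rw [gaussianReal_map_const_mul, gaussianReal_conv_gaussianReal, add_zero, add_comm w]

lemma measurable_integral_gaussianReal (r : ℝ) (w : ℝ≥0) {f : ℝ → ℝ} (hf : Measurable f) :
    Measurable fun x => ∫ z, f z ∂gaussianReal (r * x) w := by
  simp_rw [integral_gaussianReal_eq_zero_mean _ w hf]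
  exact (measurable_integral_gaussianReal_zero_mean w hf).comp (measurable_const_mul r)

/-! ### One step of the filter -/

/-- One step of the exact predictive recursion, from `η_t` to `η_{t+1}`: reweight by `G`,
normalize, and apply the mutation kernel. -/
noncomputable def predictStep (ρ σ c : ℝ) (μ : Measure ℝ) : Measure ℝ :=
  (filtering₁ c μ).bind (mutation ρ σ)

lemma lintegral_potential (c : ℝ) (hc : 0 ≤ c) (μ : Measure ℝ) [IsFiniteMeasure μ] :
    ∫⁻ x, ENNReal.ofReal (potential c x) ∂μ = ENNReal.ofReal (∫ x, potential c x ∂μ) :=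
  (ofReal_integral_eq_lintegral_ofReal (integrable_potential hc μ)
    (ae_of_all _ fun x => (potential_pos c x).le)).symm

lemma isProbabilityMeasure_filtering₁ {c : ℝ} (hc : 0 ≤ c) (μ : Measure ℝ)
    [IsProbabilityMeasure μ] : IsProbabilityMeasure (filtering₁ c μ) := by
  refine ⟨?_⟩
  have h := integral_potential_pos hc μ
  rw [filtering₁, Measure.smul_apply, withDensity_apply _ MeasurableSet.univ,
    Measure.restrict_univ, smul_eq_mul, lintegral_potential c hc]
  exact ENNReal.inv_mul_cancel (by simpa using h) ENNReal.ofReal_ne_top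

lemma integral_filtering₁ {c : ℝ} (hc : 0 ≤ c) (μ : Measure ℝ) [IsProbabilityMeasure μ]
    (f : ℝ → ℝ) :
    ∫ x, f x ∂filtering₁ c μ = (∫ x, potential c x * f x ∂μ) / ∫ x, potential c x ∂μ := by
  have h := integral_potential_pos hc μ
  rw [filtering₁, integral_smul_measure, integral_withDensity_eq_integral_toReal_smul
    (by fun_prop) (ae_of_all _ fun x => ENNReal.ofReal_lt_top), lintegral_potential c hc]
  simp_rw [ENNReal.toReal_ofReal (potential_pos c _).le, smul_eq_mul]
  rw [ENNReal.toReal_inv, ENNReal.toReal_ofReal h.le, inv_mul_eq_div]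

lemma integral_bind_mutation (ρ σ : ℝ) (μ : Measure ℝ) [IsFiniteMeasure μ] {f : ℝ → ℝ} {B : ℝ}
    (hf : Measurable f) (hb : ∀ x, |f x| ≤ B) :
    ∫ x, f x ∂μ.bind (mutation ρ σ) =
      ∫ x, ∫ y, f y ∂gaussianReal (ρ * x) (σ ^ 2).toNNReal ∂μ := by
  rw [Measure.comp_eq_comp_const_apply, Kernel.integral_comp]
  · rfl
  · rw [← Measure.comp_eq_comp_const_apply]
    exact integrable_of_abs_le hf hb

lemma isProbabilityMeasure_predictStep (ρ σ : ℝ) {c : ℝ} (hc : 0 ≤ c) (μ : Measure ℝ)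
    [IsProbabilityMeasure μ] : IsProbabilityMeasure (predictStep ρ σ c μ) := by
  have := isProbabilityMeasure_filtering₁ hc μ
  unfold predictStep
  infer_instance

lemma integral_predictStep (ρ σ : ℝ) {c : ℝ} (hc : 0 ≤ c) (μ : Measure ℝ)
    [IsProbabilityMeasure μ] {f : ℝ → ℝ} {B : ℝ} (hf : Measurable f) (hb : ∀ x, |f x| ≤ B) :
    ∫ x, f x ∂predictStep ρ σ c μ =
      (∫ x, potential c x * ∫ y, f y ∂gaussianReal (ρ * x) (σ ^ 2).toNNReal ∂μ) /
        ∫ x, potential c x ∂μ := by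
  have := isProbabilityMeasure_filtering₁ hc μ
  rw [predictStep, integral_bind_mutation ρ σ _ hf hb, integral_filtering₁ hc]

/-! ### The multi-step filter in closed form -/

/-- The precision `a_k` of the Gaussian weight of the `k`-step filter (a backward Riccati
recursion). -/
noncomputable def stepPrecision (ρ σ c : ℝ) : ℕ → ℝ
  | 0 => 0
  | k + 1 => c + ρ ^ 2 * stepPrecision ρ σ c k / (1 + σ ^ 2 * stepPrecision ρ σ c k)

/-- The gain `r_k` of the `k`-step filter: conditionally on starting at `x`, the state after `k`
steps has mean `r_k x`. -/
noncomputable def stepGain (ρ σ c : ℝ) : ℕ → ℝ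
  | 0 => 1
  | k + 1 => stepGain ρ σ c k * (ρ / (1 + σ ^ 2 * stepPrecision ρ σ c k))

/-- The conditional variance `v_k` of the state after `k` steps of the filter. -/
noncomputable def stepVar (ρ σ c : ℝ) : ℕ → ℝ≥0
  | 0 => 0
  | k + 1 => stepVar ρ σ c k + .mk (stepGain ρ σ c k ^ 2) (sq_nonneg _) *
      (σ ^ 2 / (1 + σ ^ 2 * stepPrecision ρ σ c k)).toNNReal

/-- The `k`-step filter from the law `μ`, as a functional of the test function `f`: the average of
`f` under `𝒩(r_k x, v_k)`, where `x` is drawn from `μ` reweighted by `exp(-a_k x² / 2)`. -/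
noncomputable def multiStep (ρ σ c : ℝ) (k : ℕ) (μ : Measure ℝ) (f : ℝ → ℝ) : ℝ :=
  (∫ x, potential (stepPrecision ρ σ c k) x *
      ∫ z, f z ∂gaussianReal (stepGain ρ σ c k * x) (stepVar ρ σ c k) ∂μ) /
    ∫ x, potential (stepPrecision ρ σ c k) x ∂μ

lemma multiStep_zero (ρ σ c : ℝ) (μ : Measure ℝ) [IsProbabilityMeasure μ] (f : ℝ → ℝ) :
    multiStep ρ σ c 0 μ f = ∫ x, f x ∂μ := by
  simp [multiStep, stepPrecision, stepGain, stepVar, potential_zero]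

lemma stepPrecision_nonneg (ρ σ : ℝ) {c : ℝ} (hc : 0 ≤ c) (k : ℕ) :
    0 ≤ stepPrecision ρ σ c k := by
  induction k with
  | zero => exact le_rfl
  | succ k ih => rw [stepPrecision]; positivity

lemma integral_predictStep_potential_mul (ρ σ : ℝ) {c : ℝ} (hc : 0 ≤ c) (k : ℕ) (μ : Measure ℝ)
    [IsProbabilityMeasure μ] {f : ℝ → ℝ} {B : ℝ} (hf : Measurable f) (hb : ∀ x, |f x| ≤ B) :
    ∫ x, potential (stepPrecision ρ σ c k) x *
        ∫ z, f z ∂gaussianReal (stepGain ρ σ c k * x) (stepVar ρ σ c k) ∂predictStep ρ σ c μ =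
      (√(1 + σ ^ 2 * stepPrecision ρ σ c k))⁻¹ / (∫ x, potential c x ∂μ) *
        ∫ x, potential (stepPrecision ρ σ c (k + 1)) x *
          ∫ z, f z ∂gaussianReal (stepGain ρ σ c (k + 1) * x) (stepVar ρ σ c (k + 1)) ∂μ := by
  have ha := stepPrecision_nonneg ρ σ hc k
  have hB : 0 ≤ B := (abs_nonneg _).trans (hb 0)
  rw [integral_predictStep (B := 1 * B) (f := fun x => potential (stepPrecision ρ σ c k) x *
      ∫ z, f z ∂gaussianReal (stepGain ρ σ c k * x) (stepVar ρ σ c k)) ρ σ hc μ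
    ((measurable_potential _).mul (measurable_integral_gaussianReal _ _ hf)) fun x => by
      rw [abs_mul, abs_of_pos (potential_pos _ _)]
      exact mul_le_mul (potential_le_one ha x) (abs_integral_le_of_abs_le hb) (abs_nonneg _)
        zero_le_one, div_mul_eq_mul_div, ← integral_const_mul]
  congr 2
  ext x
  rw [integral_potential_mul_gaussianReal ha, integral_gaussianReal_comp _ _ _ _ hf hb,
    stepPrecision, stepGain, stepVar, potential_add, Real.coe_toNNReal _ (sq_nonneg σ)]
  set D := 1 + σ ^ 2 * stepPrecision ρ σ c k
  have e1 : potential (stepPrecision ρ σ c k / D) (ρ * x) =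
      potential (ρ ^ 2 * stepPrecision ρ σ c k / D) x := by
    rw [potential_mul_right]
    congr 1
    ring
  have e2 : stepGain ρ σ c k * (ρ * x / D) = stepGain ρ σ c k * (ρ / D) * x := by ring
  rw [e1, e2]
  ring

/-- The semigroup property of the multi-step filter. -/
lemma multiStep_predictStep (ρ σ : ℝ) {c : ℝ} (hc : 0 ≤ c) (k : ℕ) (μ : Measure ℝ)
    [IsProbabilityMeasure μ] {f : ℝ → ℝ} {B : ℝ} (hf : Measurable f) (hb : ∀ x, |f x| ≤ B) :
    multiStep ρ σ c k (predictStep ρ σ c μ) f = multiStep ρ σ c (k + 1) μ f := by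
  have ha := stepPrecision_nonneg ρ σ hc k
  have h1 := integral_predictStep_potential_mul ρ σ hc k μ (f := fun _ => 1) (B := 1)
    measurable_const (by simp)
  simp only [integral_const, probReal_univ, smul_eq_mul, mul_one] at h1
  have hZ := integral_potential_pos hc μ
  rw [multiStep, h1, integral_predictStep_potential_mul ρ σ hc k μ hf hb,
    mul_div_mul_left _ _ (by positivity), multiStep]

/-! ### Bounds on the parameters of the multi-step filter -/

lemma le_stepPrecision_succ (ρ σ : ℝ) {c : ℝ} (hc : 0 ≤ c) (k : ℕ) :
    c ≤ stepPrecision ρ σ c (k + 1) := by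
  have := stepPrecision_nonneg ρ σ hc k
  rw [stepPrecision, le_add_iff_nonneg_right]
  positivity

lemma stepPrecision_le (ρ : ℝ) {σ c : ℝ} (hσ : 0 < σ) (hc : 0 ≤ c) (k : ℕ) :
    stepPrecision ρ σ c k ≤ c + ρ ^ 2 / σ ^ 2 := by
  cases k with
  | zero => rw [stepPrecision]; positivity
  | succ k =>
    have := stepPrecision_nonneg ρ σ hc k
    rw [stepPrecision, add_le_add_iff_left, div_le_div_iff₀ (by positivity) (by positivity)]
    nlinarith [sq_nonneg ρ]

/-- The gains decay geometrically, even when `|ρ| > 1`. -/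
lemma exists_stepGain_sq_le (ρ : ℝ) {σ c : ℝ} (hσ : 0 < σ) (hc : 0 < c) :
    ∃ D q : ℝ, 0 < D ∧ 0 < q ∧ q < 1 ∧ ∀ k, stepGain ρ σ c k ^ 2 ≤ D * q ^ k := by
  set A := c + ρ ^ 2 / σ ^ 2
  set q := (1 + σ ^ 2 * c)⁻¹ with hq
  have hA : 0 < A := by positivity
  have hq0 : 0 < q := by positivity
  -- The Riccati recursion makes the product of the squared gain factors telescope.
  have key : ∀ k, stepGain ρ σ c (k + 1) ^ 2 ≤
      ρ ^ 2 / c * stepPrecision ρ σ c (k + 1) * q ^ k := by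
    intro k
    induction k with
    | zero =>
      simp only [stepGain, stepPrecision]
      field_simp
      simp
    | succ k ih =>
      have ha := le_stepPrecision_succ ρ σ hc.le k
      rw [stepGain, show stepPrecision ρ σ c (k + 1 + 1) = c + ρ ^ 2 * stepPrecision ρ σ c (k + 1) /
        (1 + σ ^ 2 * stepPrecision ρ σ c (k + 1)) from rfl]
      generalize stepPrecision ρ σ c (k + 1) = a at *
      have ha0 : 0 < a := hc.trans_le ha
      have hD : 0 < 1 + σ ^ 2 * a := by positivity
      have h1 : (1 + σ ^ 2 * a)⁻¹ ≤ q := inv_anti₀ (by positivity) (by gcongr)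
      calc (stepGain ρ σ c (k + 1) * (ρ / (1 + σ ^ 2 * a))) ^ 2
          = stepGain ρ σ c (k + 1) ^ 2 * (ρ ^ 2 * (1 + σ ^ 2 * a)⁻¹ * (1 + σ ^ 2 * a)⁻¹) := by ring
        _ ≤ ρ ^ 2 / c * a * q ^ k * (ρ ^ 2 * (1 + σ ^ 2 * a)⁻¹ * q) := by gcongr
        _ = ρ ^ 2 / c * (ρ ^ 2 * a / (1 + σ ^ 2 * a)) * q ^ (k + 1) := by ring
        _ ≤ ρ ^ 2 / c * (c + ρ ^ 2 * a / (1 + σ ^ 2 * a)) * q ^ (k + 1) := by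
          gcongr
          linarith
  refine ⟨1 + ρ ^ 2 / c * A / q, q, by positivity, hq0, inv_lt_one_of_one_lt₀ (by
    rw [lt_add_iff_pos_right]; positivity), fun k => ?_⟩
  cases k with
  | zero =>
    have : 0 ≤ ρ ^ 2 / c * A / q := by positivity
    simp [stepGain]
    linarith
  | succ k =>
    calc stepGain ρ σ c (k + 1) ^ 2 ≤ ρ ^ 2 / c * stepPrecision ρ σ c (k + 1) * q ^ k := key k
      _ ≤ ρ ^ 2 / c * A * q ^ k := by gcongr; exact stepPrecision_le ρ hσ hc.le _
      _ = ρ ^ 2 / c * A / q * q ^ (k + 1) := by field_simp; ring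
      _ ≤ (1 + ρ ^ 2 / c * A / q) * q ^ (k + 1) := by gcongr; linarith

lemma coe_stepVar_succ (ρ σ : ℝ) {c : ℝ} (hc : 0 ≤ c) (k : ℕ) :
    (stepVar ρ σ c (k + 1) : ℝ) = stepVar ρ σ c k +
      stepGain ρ σ c k ^ 2 * (σ ^ 2 / (1 + σ ^ 2 * stepPrecision ρ σ c k)) := by
  have := stepPrecision_nonneg ρ σ hc k
  rw [stepVar, NNReal.coe_add, NNReal.coe_mul, Real.coe_toNNReal _ (by positivity)]
  rfl

lemma sq_le_stepVar_succ (ρ σ : ℝ) {c : ℝ} (hc : 0 ≤ c) (k : ℕ) :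
    σ ^ 2 ≤ stepVar ρ σ c (k + 1) := by
  induction k with
  | zero => rw [coe_stepVar_succ ρ σ hc]; simp [stepVar, stepGain, stepPrecision]
  | succ k ih =>
    have := stepPrecision_nonneg ρ σ hc (k + 1)
    rw [coe_stepVar_succ ρ σ hc]
    exact ih.trans (le_add_of_nonneg_right (by positivity))

lemma exists_stepVar_le (ρ : ℝ) {σ c : ℝ} (hσ : 0 < σ) (hc : 0 < c) :
    ∃ V : ℝ, 0 < V ∧ ∀ k, (stepVar ρ σ c k : ℝ) ≤ V := by
  obtain ⟨D, q, hD, hq0, hq1, h⟩ := exists_stepGain_sq_le ρ hσ hc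
  have key : ∀ k, (stepVar ρ σ c k : ℝ) ≤ σ ^ 2 * D * ∑ j ∈ Finset.range k, q ^ j := by
    intro k
    induction k with
    | zero => simp [stepVar]
    | succ k ih =>
      have ha := stepPrecision_nonneg ρ σ hc.le k
      have h1 : σ ^ 2 / (1 + σ ^ 2 * stepPrecision ρ σ c k) ≤ σ ^ 2 :=
        div_le_self (by positivity) (le_add_of_nonneg_right (by positivity))
      rw [coe_stepVar_succ ρ σ hc.le, Finset.sum_range_succ, mul_add]
      refine add_le_add ih ?_
      calc _ ≤ D * q ^ k * σ ^ 2 := by gcongr; exact h k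
        _ = _ := by ring
  refine ⟨σ ^ 2 * D * (1 - q)⁻¹, by have := sub_pos.2 hq1; positivity, fun k => (key k).trans ?_⟩
  gcongr
  rw [← tsum_geometric_of_lt_one hq0.le hq1]
  exact (summable_geometric_of_lt_one hq0.le hq1).sum_le_tsum _ fun _ _ => by positivity

/-! ### Test functions and the Kolmogorov distance -/

lemma integral_indicator_Iic (μ : Measure ℝ) [IsProbabilityMeasure μ] (b : ℝ) :
    ∫ x, (Set.Iic b).indicator 1 x ∂μ = cdf μ b := by
  rw [integral_indicator_one measurableSet_Iic, cdf_eq_real]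

lemma abs_indicator_Iic_le (b x : ℝ) : |(Set.Iic b).indicator (1 : ℝ → ℝ) x| ≤ 1 := by
  by_cases h : x ≤ b <;> simp [h]

lemma measurable_indicator_Iic (b : ℝ) : Measurable ((Set.Iic b).indicator (1 : ℝ → ℝ)) :=
  measurable_one.indicator measurableSet_Iic

lemma integral_integral_Ioi (μ : Measure ℝ) [IsProbabilityMeasure μ] {w : ℝ → ℝ}
    (hw : Integrable w) :
    ∫ x, (∫ y in Set.Ioi x, w y) ∂μ = ∫ y, cdf μ y * w y := by
  have h1 : ∀ x, ∫ y in Set.Ioi x, w y = ∫ y, {p : ℝ × ℝ | p.1 ≤ p.2}.indicator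
      (fun p => w p.2) (x, y) := by
    intro x
    rw [← integral_Ici_eq_integral_Ioi, ← integral_indicator measurableSet_Ici]
    rfl
  have h2 : ∀ y, ∫ x, {p : ℝ × ℝ | p.1 ≤ p.2}.indicator (fun p => w p.2) (x, y) ∂μ =
      cdf μ y * w y := by
    intro y
    rw [← integral_indicator_Iic, ← integral_mul_const]
    congr 1
    ext x
    by_cases h : x ≤ y <;> simp [h]
  simp_rw [h1]
  rw [integral_integral_swap]
  · simp_rw [h2]
  · exact (hw.comp_snd μ).indicator (measurableSet_le measurable_fst measurable_snd)

lemma integrable_cdf_mul (μ : Measure ℝ) {w : ℝ → ℝ} (hw : Integrable w) :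
    Integrable fun y => cdf μ y * w y :=
  hw.bdd_mul (c := 1) (monotone_cdf μ).measurable.aestronglyMeasurable (ae_of_all _ fun y => by
    rw [Real.norm_of_nonneg (cdf_nonneg μ y)]
    exact cdf_le_one μ y)

lemma abs_integral_integral_Ioi_sub_le (μ ν : Measure ℝ) [IsProbabilityMeasure μ]
    [IsProbabilityMeasure ν] {E : ℝ} (hE : ∀ y, |cdf μ y - cdf ν y| ≤ E) {w : ℝ → ℝ}
    (hw : Integrable w) :
    |∫ x, (∫ y in Set.Ioi x, w y) ∂μ - ∫ x, (∫ y in Set.Ioi x, w y) ∂ν| ≤ E * ∫ y, |w y| := by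
  rw [integral_integral_Ioi μ hw, integral_integral_Ioi ν hw,
    ← integral_sub (integrable_cdf_mul μ hw) (integrable_cdf_mul ν hw), ← integral_const_mul]
  refine abs_integral_le_integral_abs.trans (integral_mono
    ((integrable_cdf_mul μ hw).sub (integrable_cdf_mul ν hw)).abs (hw.abs.const_mul E) fun y => ?_)
  simp only
  rw [← sub_mul, abs_mul]
  exact mul_le_mul_of_nonneg_right (hE y) (abs_nonneg _)

/-- Koksma–Hlawka type bound: smooth test functions vanishing at `+∞` integrate to nearly the same
value under laws that are close in Kolmogorov distance. -/
lemma abs_integral_sub_le_of_hasDerivAt (μ ν : Measure ℝ) [IsProbabilityMeasure μ]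
    [IsProbabilityMeasure ν] {E : ℝ} (hE : ∀ y, |cdf μ y - cdf ν y| ≤ E) {f f' : ℝ → ℝ}
    (hf : ∀ x, HasDerivAt f (f' x) x) (hf' : Integrable f') (h0 : Tendsto f atTop (𝓝 0)) :
    |∫ x, f x ∂μ - ∫ x, f x ∂ν| ≤ E * ∫ y, |f' y| := by
  have h1 : ∀ x, f x = ∫ y in Set.Ioi x, -f' y := by
    intro x
    rw [integral_neg, integral_Ioi_of_hasDerivAt_of_tendsto' (fun y _ => hf y) hf'.integrableOn h0]
    ring
  simpa only [← h1, Pi.neg_apply, abs_neg] using abs_integral_integral_Ioi_sub_le μ ν hE hf'.neg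

/-- The same for a smooth function cut off at `b`. -/
lemma abs_integral_indicator_sub_le_of_hasDerivAt (μ ν : Measure ℝ) [IsProbabilityMeasure μ]
    [IsProbabilityMeasure ν] {E : ℝ} (hE : ∀ y, |cdf μ y - cdf ν y| ≤ E) {f f' : ℝ → ℝ}
    (hf : ∀ x, HasDerivAt f (f' x) x) (hf' : Integrable f') (b : ℝ)
    (hμ : Integrable (fun x => f x * (Set.Iic b).indicator 1 x) μ)
    (hν : Integrable (fun x => f x * (Set.Iic b).indicator 1 x) ν) :
    |∫ x, f x * (Set.Iic b).indicator 1 x ∂μ - ∫ x, f x * (Set.Iic b).indicator 1 x ∂ν| ≤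
      E * (|f b| + ∫ y, |f' y|) := by
  have hE0 : 0 ≤ E := (abs_nonneg _).trans (hE 0)
  have hw : Integrable ((Set.Iic b).indicator fun y => -f' y) := hf'.neg.indicator measurableSet_Iic
  have h1 : ∀ x, ∫ y in Set.Ioi x, (Set.Iic b).indicator (fun y => -f' y) y =
      f x * (Set.Iic b).indicator 1 x - f b * (Set.Iic b).indicator 1 x := by
    intro x
    rw [setIntegral_indicator measurableSet_Iic, Set.Ioi_inter_Iic]
    rcases le_or_gt x b with h | h
    · rw [← intervalIntegral.integral_of_le h, intervalIntegral.integral_neg,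
        intervalIntegral.integral_eq_sub_of_hasDerivAt (fun y _ => hf y) hf'.intervalIntegrable]
      simp [h]
    · simp [Set.Ioc_eq_empty_of_le h.le, h.not_ge]
  have hi : ∀ μ : Measure ℝ, IsProbabilityMeasure μ →
      Integrable (fun x => f b * (Set.Iic b).indicator 1 x) μ := fun μ _ =>
    (integrable_of_abs_le (measurable_indicator_Iic b) (abs_indicator_Iic_le b)).const_mul _
  have key := abs_integral_integral_Ioi_sub_le μ ν hE hw
  simp_rw [h1] at key
  rw [integral_sub hμ (hi μ inferInstance), integral_sub hν (hi ν inferInstance),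
    integral_const_mul, integral_const_mul, integral_indicator_Iic, integral_indicator_Iic] at key
  have h2 : ∫ y, |(Set.Iic b).indicator (fun y => -f' y) y| ≤ ∫ y, |f' y| := by
    refine integral_mono hw.abs hf'.abs fun y => ?_
    by_cases h : y ≤ b <;> simp [h]
  have h3 : |f b * (cdf μ b - cdf ν b)| ≤ |f b| * E := by
    rw [abs_mul]
    exact mul_le_mul_of_nonneg_left (hE b) (abs_nonneg _)
  have h4 := mul_le_mul_of_nonneg_left h2 hE0
  rw [abs_le] at *
  constructor <;> nlinarith

/-! ### Stability of the multi-step filter -/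

lemma hasDerivAt_potential (a x : ℝ) : HasDerivAt (potential a) (-(a * x) * potential a x) x := by
  have h : HasDerivAt (fun x : ℝ => -(a * x ^ 2) / 2) (-(a * x)) x := by
    have := (((hasDerivAt_id x).pow 2).const_mul a).neg.div_const 2
    refine this.congr_deriv ?_
    simp
    ring
  exact h.exp.congr_deriv (mul_comm _ _)

lemma tendsto_potential_atTop {a : ℝ} (ha : 0 < a) : Tendsto (potential a) atTop (𝓝 0) := by
  refine Real.tendsto_exp_atBot.comp ?_
  have : Tendsto (fun x : ℝ => x ^ 2 * (a / 2)) atTop atTop :=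
    (tendsto_pow_atTop two_ne_zero).atTop_mul_const (by positivity)
  exact (tendsto_neg_atTop_atBot.comp this).congr fun x => by simp; ring

lemma integrable_one_add_sq_mul_potential {c : ℝ} (hc : 0 < c) :
    Integrable fun x => (1 + x ^ 2) * potential c x := by
  have h1 := integrable_exp_neg_mul_sq (half_pos hc)
  have h2 := integrable_rpow_mul_exp_neg_mul_sq (half_pos hc) (s := 2) (by norm_num)
  refine (h1.add h2).congr (ae_of_all _ fun x => ?_)
  simp only [Pi.add_apply, Real.rpow_two, potential]
  rw [show -(c * x ^ 2) / 2 = -(c / 2) * x ^ 2 by ring]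
  ring

lemma abs_mul_potential_le {c : ℝ} (hc : 0 < c) (x : ℝ) : |x| * potential c x ≤ 1 + 2 / c := by
  have h1 : c * x ^ 2 / 2 * potential c x ≤ 1 := by
    rw [potential, neg_div, Real.exp_neg, ← div_eq_mul_inv, div_le_one (Real.exp_pos _)]
    linarith [Real.add_one_le_exp (c * x ^ 2 / 2)]
  have h2 : x ^ 2 * potential c x ≤ 2 / c := by
    rw [le_div_iff₀ hc]
    linarith
  have h3 : |x| ≤ 1 + x ^ 2 := by
    rw [← sq_abs]
    nlinarith [sq_nonneg (|x| - 1), abs_nonneg x]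
  have h4 := mul_le_mul_of_nonneg_right h3 (potential_pos c x).le
  linarith [potential_le_one hc.le x]

lemma gaussianPDFReal_le {σ : ℝ} (hσ : 0 < σ) {s : ℝ≥0} (hs : σ ^ 2 ≤ s) (m y : ℝ) :
    gaussianPDFReal m s y ≤ σ⁻¹ := by
  have hs0 : (0 : ℝ) < s := (by positivity : (0 : ℝ) < σ ^ 2).trans_le hs
  have h1 : Real.exp (-(y - m) ^ 2 / (2 * s)) ≤ 1 :=
    Real.exp_le_one_iff.2 (div_nonpos_of_nonpos_of_nonneg (by nlinarith [sq_nonneg (y - m)])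
      (by positivity))
  have h2 : σ ≤ √(2 * Real.pi * s) :=
    Real.le_sqrt_of_sq_le (by nlinarith [Real.pi_gt_three])
  calc gaussianPDFReal m s y ≤ (√(2 * Real.pi * s))⁻¹ * 1 := by
        rw [gaussianPDFReal]; gcongr
    _ ≤ σ⁻¹ := by rw [mul_one]; exact inv_anti₀ hσ h2

lemma continuous_gaussianPDFReal (m : ℝ) (s : ℝ≥0) : Continuous (gaussianPDFReal m s) := by
  unfold gaussianPDFReal
  fun_prop

/-- The mass given to `(-∞, b]` by `𝒩(r x, s)` is a smooth function of `x`. -/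
lemma hasDerivAt_integral_indicator_gaussianReal (r b : ℝ) {s : ℝ≥0} (hs : s ≠ 0) (x : ℝ) :
    HasDerivAt (fun x => ∫ z, (Set.Iic b).indicator 1 z ∂gaussianReal (r * x) s)
      (gaussianPDFReal 0 s (b - r * x) * -r) x := by
  have hint := integrable_gaussianPDFReal 0 s
  have h1 : ∀ x, ∫ z, (Set.Iic b).indicator 1 z ∂gaussianReal (r * x) s =
      (∫ y in Set.Iic 0, gaussianPDFReal 0 s y) + ∫ y in (0 : ℝ)..(b - r * x),
        gaussianPDFReal 0 s y := by
    intro x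
    rw [integral_gaussianReal_eq_zero_mean _ _ (measurable_indicator_Iic b),
      integral_gaussianReal_eq_integral_smul hs,
      ← intervalIntegral.integral_Iic_sub_Iic hint.integrableOn hint.integrableOn,
      add_sub_cancel, ← integral_indicator measurableSet_Iic]
    congr 1
    ext y
    by_cases h : y ≤ b - r * x
    · have h' : r * x + y ≤ b := by linarith
      simp [h, h']
    · have h' : ¬ r * x + y ≤ b := by intro h'; exact h (by linarith)
      simp [h, h']
  simp_rw [h1]
  have h2 : HasDerivAt (fun x => b - r * x) (-r) x := by
    simpa using ((hasDerivAt_id x).const_mul r).const_sub b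
  have h3 := intervalIntegral.integral_hasDerivAt_right (a := 0) (b := b - r * x)
    hint.intervalIntegrable
    ((continuous_gaussianPDFReal 0 s).stronglyMeasurableAtFilter _ _)
    (continuous_gaussianPDFReal 0 s).continuousAt
  exact (h3.comp x h2).const_add _

lemma abs_div_sub_div_le {X X' B B' κ α β γ : ℝ} (hκ : 0 < κ) (hB : κ ≤ B) (hB' : κ ≤ B')
    (hX : |X - X'| ≤ α) (hX' : |X'| ≤ β) (hBB : |B - B'| ≤ γ) :
    |X / B - X' / B'| ≤ α / κ + β * γ / κ ^ 2 := by
  have hB0 := hκ.trans_le hB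
  have hB0' := hκ.trans_le hB'
  have e : X / B - X' / B' = (X - X') / B - X' * (B - B') / (B * B') := by
    field_simp
    ring
  have hα := (abs_nonneg _).trans hX
  have hβ := (abs_nonneg _).trans hX'
  have hγ := (abs_nonneg _).trans hBB
  rw [e]
  refine (abs_sub _ _).trans (add_le_add ?_ ?_)
  · rw [abs_div, abs_of_pos hB0]
    gcongr
  · rw [abs_div, abs_mul, abs_of_pos (mul_pos hB0 hB0'), sq]
    gcongr

/-- Exponential stability: the effect of a Kolmogorov perturbation of the law after `k + 1` steps
of the filter is proportional to the gain `r_{k+1}`. Subtracting the value at `x = 0` from the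
mass of `(-∞, b]` makes the test function itself of the order of the gain. -/
lemma exists_abs_multiStep_sub_le (ρ : ℝ) {σ c : ℝ} (hσ : 0 < σ) (hc : 0 < c) :
    ∃ C : ℝ, 0 < C ∧ ∀ (μ ν : Measure ℝ) [IsProbabilityMeasure μ] [IsProbabilityMeasure ν]
      (E κ : ℝ), (∀ y, |cdf μ y - cdf ν y| ≤ E) → 0 < κ →
      κ ≤ ∫ x, potential (c + ρ ^ 2 / σ ^ 2) x ∂μ → κ ≤ ∫ x, potential (c + ρ ^ 2 / σ ^ 2) x ∂ν →
      ∀ (k : ℕ) (b : ℝ), |multiStep ρ σ c (k + 1) μ ((Set.Iic b).indicator 1) -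
        multiStep ρ σ c (k + 1) ν ((Set.Iic b).indicator 1)| ≤
          C * |stepGain ρ σ c (k + 1)| * E / κ ^ 2 := by
  set A := c + ρ ^ 2 / σ ^ 2 with hA
  have hA0 : 0 < A := by positivity
  set K := ∫ x, (A + 1) * ((1 + x ^ 2) * potential c x) with hK
  have hKint := (integrable_one_add_sq_mul_potential hc).const_mul (A + 1)
  have hK0 : 0 ≤ K := integral_nonneg fun x => by
    have := potential_pos c x
    positivity
  refine ⟨σ⁻¹ * (K + (1 + 2 / c) * K) + 1, by positivity, ?_⟩
  intro μ ν _ _ E κ hE hκ hμ hν k b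
  set a := stepPrecision ρ σ c (k + 1)
  set r := stepGain ρ σ c (k + 1)
  set s := stepVar ρ σ c (k + 1)
  have hca : c ≤ a := le_stepPrecision_succ ρ σ hc.le k
  have haA : a ≤ A := stepPrecision_le ρ hσ hc.le _
  have ha0 : 0 < a := hc.trans_le hca
  have hs : σ ^ 2 ≤ s := sq_le_stepVar_succ ρ σ hc.le k
  have hs0 : s ≠ 0 := by
    have : (0 : ℝ) < s := (by positivity : (0 : ℝ) < σ ^ 2).trans_le hs
    exact_mod_cast this.ne'
  have hE0 : 0 ≤ E := (abs_nonneg _).trans (hE 0)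
  have hκ1 : κ ≤ 1 := hμ.trans (integral_potential_le_one hA0.le μ)
  set q : ℝ → ℝ := fun x => ∫ z, (Set.Iic b).indicator 1 z ∂gaussianReal (r * x) s with hq
  have hqd : ∀ x, HasDerivAt q (gaussianPDFReal 0 s (b - r * x) * -r) x :=
    hasDerivAt_integral_indicator_gaussianReal r b hs0
  have hq' : ∀ x, |gaussianPDFReal 0 s (b - r * x) * -r| ≤ σ⁻¹ * |r| := by
    intro x
    rw [abs_mul, abs_neg, abs_of_nonneg (gaussianPDFReal_nonneg _ _ _)]
    exact mul_le_mul_of_nonneg_right (gaussianPDFReal_le hσ hs _ _) (abs_nonneg _)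
  have hqc : Continuous q := continuous_iff_continuousAt.2 fun x => (hqd x).continuousAt
  have hq1 : ∀ x, |q x| ≤ 1 := fun x => abs_integral_le_of_abs_le (abs_indicator_Iic_le b)
  have hqL : ∀ x, |q x - q 0| ≤ σ⁻¹ * |r| * |x| := by
    intro x
    have := convex_univ.norm_image_sub_le_of_norm_hasDerivWithin_le
      (fun y _ => (hqd y).hasDerivWithinAt) (fun y _ => hq' y) (Set.mem_univ 0) (Set.mem_univ x)
    simpa using this
  have hpot : ∀ x, potential a x ≤ potential c x := potential_le_potential hca
  -- Both the centred test function and its derivative are of order `|r|`, with integrable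
  -- Gaussian factors that do not depend on `k`.
  set f : ℝ → ℝ := fun x => potential a x * (q x - q 0) with hf
  set f' : ℝ → ℝ := fun x => -(a * x) * potential a x * (q x - q 0) +
    potential a x * (gaussianPDFReal 0 s (b - r * x) * -r) with hf'
  have hfd : ∀ x, HasDerivAt f (f' x) x := fun x =>
    (hasDerivAt_potential a x).mul ((hqd x).sub_const _)
  have hf'b : ∀ x, |f' x| ≤ σ⁻¹ * |r| * ((A + 1) * ((1 + x ^ 2) * potential c x)) := by
    intro x
    have h1 : |-(a * x) * potential a x * (q x - q 0)| ≤
        A * |x| * potential c x * (σ⁻¹ * |r| * |x|) := by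
      rw [abs_mul, abs_mul, abs_neg, abs_mul, abs_of_pos ha0, abs_of_pos (potential_pos a x)]
      have := (potential_pos a x).le
      have := (potential_pos c x).le
      exact mul_le_mul (mul_le_mul (by gcongr) (hpot x) ‹_› (by positivity)) (hqL x)
        (abs_nonneg _) (by positivity)
    have h2 : |potential a x * (gaussianPDFReal 0 s (b - r * x) * -r)| ≤
        potential c x * (σ⁻¹ * |r|) := by
      rw [abs_mul, abs_of_pos (potential_pos a x)]
      exact mul_le_mul (hpot x) (hq' x) (abs_nonneg _) (potential_pos c x).le
    refine (abs_add_le _ _).trans ((add_le_add h1 h2).trans ?_)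
    have h3 : A * |x| * potential c x * (σ⁻¹ * |r| * |x|) + potential c x * (σ⁻¹ * |r|) =
        σ⁻¹ * |r| * potential c x * (A * x ^ 2 + 1) := by
      rw [← sq_abs x]
      ring
    have h4 : A * x ^ 2 + 1 ≤ (A + 1) * (1 + x ^ 2) := by nlinarith [sq_nonneg x]
    rw [h3]
    have h5 : 0 ≤ σ⁻¹ * |r| * potential c x := by
      have := potential_pos c x
      positivity
    nlinarith [mul_le_mul_of_nonneg_left h4 h5]
  have hgc := continuous_gaussianPDFReal 0 s
  have hf'c : Continuous f' := by fun_prop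
  have hf'i : Integrable f' := (hKint.const_mul (σ⁻¹ * |r|)).mono' hf'c.aestronglyMeasurable
    (ae_of_all _ hf'b)
  have hf0 : Tendsto f atTop (𝓝 0) := by
    refine squeeze_zero_norm (fun x => ?_) (by simpa using (tendsto_potential_atTop ha0).mul_const 2)
    rw [Real.norm_eq_abs, abs_mul, abs_of_pos (potential_pos a x)]
    refine mul_le_mul_of_nonneg_left ?_ (potential_pos a x).le
    exact (abs_sub _ _).trans (by linarith [hq1 x, hq1 0])
  have hX := abs_integral_sub_le_of_hasDerivAt μ ν hE hfd hf'i hf0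
  have hfK : ∫ y, |f' y| ≤ σ⁻¹ * |r| * K := by
    rw [hK, ← integral_const_mul]
    exact integral_mono hf'i.abs (hKint.const_mul _) hf'b
  -- The normalizing constant is the integral of a smooth function too, but not a centred one: its
  -- perturbation gets its factor `|r|` from the numerator it multiplies.
  have hgb : ∀ x, |-(a * x) * potential a x| ≤ (A + 1) * ((1 + x ^ 2) * potential c x) := by
    intro x
    have h1 : |-(a * x) * potential a x| ≤ A * |x| * potential c x := by
      rw [abs_mul, abs_neg, abs_mul, abs_of_pos ha0, abs_of_pos (potential_pos a x)]
      have := (potential_pos a x).le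
      gcongr
      exact hpot x
    have h2 : |x| ≤ 1 + x ^ 2 := by
      rw [← sq_abs]
      nlinarith [sq_nonneg (|x| - 1), abs_nonneg x]
    have h3 : A * |x| ≤ (A + 1) * (1 + x ^ 2) := by nlinarith [abs_nonneg x]
    nlinarith [mul_le_mul_of_nonneg_right h3 (potential_pos c x).le]
  have hgi : Integrable fun x => -(a * x) * potential a x :=
    hKint.mono' (by fun_prop) (ae_of_all _ hgb)
  have hB := abs_integral_sub_le_of_hasDerivAt μ ν hE (hasDerivAt_potential a) hgi
    (tendsto_potential_atTop ha0)
  have hgK : ∫ y, |-(a * y) * potential a y| ≤ K := integral_mono hgi.abs hKint hgb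
  have hX' : |∫ x, f x ∂ν| ≤ σ⁻¹ * |r| * (1 + 2 / c) := by
    refine abs_integral_le_of_abs_le fun x => ?_
    rw [hf, abs_mul, abs_of_pos (potential_pos a x)]
    calc potential a x * |q x - q 0| ≤ potential c x * (σ⁻¹ * |r| * |x|) :=
          mul_le_mul (hpot x) (hqL x) (abs_nonneg _) (potential_pos c x).le
      _ = σ⁻¹ * |r| * (|x| * potential c x) := by ring
      _ ≤ _ := by gcongr; exact abs_mul_potential_le hc x
  have hms : ∀ (π : Measure ℝ) [IsProbabilityMeasure π],
      multiStep ρ σ c (k + 1) π ((Set.Iic b).indicator 1) =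
        (∫ x, f x ∂π) / (∫ x, potential a x ∂π) + q 0 := by
    intro π _
    have hZ := integral_potential_pos ha0.le π
    have h1 : ∫ x, f x ∂π = ∫ x, potential a x * q x ∂π - (∫ x, potential a x ∂π) * q 0 := by
      rw [← integral_mul_const, ← integral_sub]
      · simp_rw [hf, mul_sub]
      · refine integrable_of_abs_le (B := 1) (by fun_prop) fun x => ?_
        rw [abs_mul, abs_of_pos (potential_pos a x)]
        exact mul_le_one₀ (potential_le_one ha0.le x) (abs_nonneg _) (hq1 x)
      · exact (integrable_potential ha0.le π).mul_const _
    rw [h1, multiStep, sub_div, mul_div_cancel_left₀ _ hZ.ne', sub_add_cancel]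
  have hBμ : κ ≤ ∫ x, potential a x ∂μ := hμ.trans (integral_mono (integrable_potential hA0.le μ)
    (integrable_potential ha0.le μ) (potential_le_potential haA))
  have hBν : κ ≤ ∫ x, potential a x ∂ν := hν.trans (integral_mono (integrable_potential hA0.le ν)
    (integrable_potential ha0.le ν) (potential_le_potential haA))
  rw [hms μ, hms ν, add_sub_add_right_eq_sub]
  refine (abs_div_sub_div_le hκ hBμ hBν (hX.trans (mul_le_mul_of_nonneg_left hfK hE0)) hX'
    (hB.trans (mul_le_mul_of_nonneg_left hgK hE0))).trans ?_
  have h1 : E * (σ⁻¹ * |r| * K) / κ ≤ E * (σ⁻¹ * |r| * K) / κ ^ 2 := by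
    gcongr
    nlinarith
  have h2 : 0 ≤ |r| * E / κ ^ 2 := by positivity
  calc _ ≤ E * (σ⁻¹ * |r| * K) / κ ^ 2 + σ⁻¹ * |r| * (1 + 2 / c) * (E * K) / κ ^ 2 := by gcongr
    _ = σ⁻¹ * (K + (1 + 2 / c) * K) * (|r| * E / κ ^ 2) := by ring
    _ ≤ (σ⁻¹ * (K + (1 + 2 / c) * K) + 1) * (|r| * E / κ ^ 2) := by gcongr; linarith
    _ = _ := by ring

/-! ### Regions under monotone graphs and `(0,2)`-sequences -/

lemma card_filter_range_le_add_one (L : ℕ) {y : ℝ} (hy : 0 ≤ y) :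
    (((Finset.range L).filter fun j : ℕ => (j : ℝ) ≤ y).card : ℝ) ≤ y + 1 := by
  have h : ((Finset.range L).filter fun j : ℕ => (j : ℝ) ≤ y) ⊆ Finset.range (⌊y⌋₊ + 1) := by
    intro j hj
    rw [Finset.mem_filter] at hj
    exact Finset.mem_range_succ_iff.2 (Nat.le_floor hj.2)
  calc _ ≤ ((⌊y⌋₊ + 1 : ℕ) : ℝ) := by
        exact_mod_cast (Finset.card_le_card h).trans_eq (Finset.card_range _)
    _ ≤ y + 1 := by push_cast; linarith [Nat.floor_le hy]

lemma sub_one_le_card_filter_range {L : ℕ} {y : ℝ} (hyL : y ≤ L) :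
    y - 1 ≤ ((Finset.range L).filter fun j : ℕ => (j : ℝ) + 1 ≤ y).card := by
  have h : Finset.range ⌊y⌋₊ ⊆ (Finset.range L).filter fun j : ℕ => (j : ℝ) + 1 ≤ y := by
    intro j hj
    rw [Finset.mem_range, ← Nat.add_one_le_iff, Nat.le_floor_iff' (by omega)] at hj
    push_cast at hj
    rw [Finset.mem_filter, Finset.mem_range]
    have : (j : ℝ) < L := by linarith
    exact ⟨by exact_mod_cast this, hj⟩
  calc y - 1 ≤ ((⌊y⌋₊ : ℕ) : ℝ) := (Nat.sub_one_lt_floor y).le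
    _ ≤ _ := by exact_mod_cast (Finset.card_range _).symm.trans_le (Finset.card_le_card h)

lemma mem_Ico_div_iff_floor_eq {K : ℕ} (hK : 0 < K) {x : ℝ} (hx : 0 ≤ x) (i : ℕ) :
    x ∈ Set.Ico ((i : ℝ) / K) (((i : ℝ) + 1) / K) ↔ ⌊K * x⌋₊ = i := by
  have hK' : (0 : ℝ) < K := by exact_mod_cast hK
  rw [Nat.floor_eq_iff (by positivity), Set.mem_Ico, div_le_iff₀' hK', lt_div_iff₀' hK']

/-- In a net of `2^(d₁+d₂)` points every cell of the `2^d₁ × 2^d₂` grid contains one point. -/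
lemma IsNet.card_filter_floor_eq_one {d₁ d₂ : ℕ} {I : Finset ℕ} {u : ℕ → Fin 2 → ℝ}
    (h : IsNet 0 (d₁ + d₂) 2 I u) {i j : ℕ} (hi : i < 2 ^ d₁) (hj : j < 2 ^ d₂) :
    (I.filter fun n => ⌊((2 ^ d₁ : ℕ) : ℝ) * u n 0⌋₊ = i ∧
      ⌊((2 ^ d₂ : ℕ) : ℝ) * u n 1⌋₊ = j).card = 1 := by
  classical
  have key := h.2.2.2 ![i, j] ![d₁, d₂] (by simp [Fin.forall_fin_two, hi, hj]) (by simp)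
  rw [pow_zero] at key
  refine Eq.trans (congrArg Finset.card ?_) key
  refine Finset.filter_congr fun n hn => ?_
  have h01 := h.2.2.1 n hn
  rw [baryBox, Set.mem_univ_pi, Fin.forall_fin_two,
    ← mem_Ico_div_iff_floor_eq (by positivity) (h01 0).1,
    ← mem_Ico_div_iff_floor_eq (by positivity) (h01 1).1]
  simp

/-- A point of the net lies under the graph only if its cell meets the region below the graph, and
does so whenever its cell is contained in that region. -/
lemma IsNet.card_filter_le_bounds {d₁ d₂ : ℕ} {I : Finset ℕ} {u : ℕ → Fin 2 → ℝ}
    (h : IsNet 0 (d₁ + d₂) 2 I u) {ψ : ℝ → ℝ} {lo hi : ℕ → ℝ}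
    (hlo : ∀ i : ℕ, i < 2 ^ d₁ → ∀ x ∈ Set.Icc ((i : ℝ) / (2 ^ d₁ : ℕ)) (((i : ℝ) + 1) / (2 ^ d₁ : ℕ)),
      lo i ≤ ψ x)
    (hhi : ∀ i : ℕ, i < 2 ^ d₁ → ∀ x ∈ Set.Icc ((i : ℝ) / (2 ^ d₁ : ℕ)) (((i : ℝ) + 1) / (2 ^ d₁ : ℕ)),
      ψ x ≤ hi i)
    (hlo1 : ∀ i < 2 ^ d₁, lo i ≤ 1) (hhi0 : ∀ i < 2 ^ d₁, 0 ≤ hi i) :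
    ∑ i ∈ Finset.range (2 ^ d₁), ((2 ^ d₂ : ℕ) * lo i - 1) ≤
        ((I.filter fun n => u n 1 ≤ ψ (u n 0)).card : ℝ) ∧
      ((I.filter fun n => u n 1 ≤ ψ (u n 0)).card : ℝ) ≤
        ∑ i ∈ Finset.range (2 ^ d₁), ((2 ^ d₂ : ℕ) * hi i + 1) := by
  classical
  set K := 2 ^ d₁ with hK
  set L := 2 ^ d₂ with hL
  have hK0 : 0 < K := by positivity
  have hL0 : 0 < L := by positivity
  have hK0' : (0 : ℝ) < K := by exact_mod_cast hK0
  have hL0' : (0 : ℝ) < L := by exact_mod_cast hL0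
  set S := I.filter fun n => u n 1 ≤ ψ (u n 0)
  set e : ℕ → ℕ → ℕ := fun i j =>
    ((S.filter fun n => ⌊(K : ℝ) * u n 0⌋₊ = i).filter fun n => ⌊(L : ℝ) * u n 1⌋₊ = j).card with he
  have hfloor : ∀ (M : ℕ), 0 < M → ∀ n ∈ I, ∀ k, ⌊(M : ℝ) * u n k⌋₊ < M := by
    intro M hM n hn k
    have h01 := h.2.2.1 n hn k
    have hM' : (0 : ℝ) < M := by exact_mod_cast hM
    rw [Nat.floor_lt (mul_nonneg hM'.le h01.1)]
    exact mul_lt_of_lt_one_right hM' h01.2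
  have hcard : S.card = ∑ i ∈ Finset.range K, ∑ j ∈ Finset.range L, e i j := by
    rw [Finset.card_eq_sum_card_fiberwise (f := fun n => ⌊(K : ℝ) * u n 0⌋₊) (t := Finset.range K)
      fun n hn => Finset.mem_coe.2 (Finset.mem_range.2
        (hfloor K hK0 n (Finset.mem_filter.1 hn).1 0))]
    refine Finset.sum_congr rfl fun i _ => ?_
    rw [Finset.card_eq_sum_card_fiberwise (f := fun n => ⌊(L : ℝ) * u n 1⌋₊) (t := Finset.range L)
      fun n hn => Finset.mem_coe.2 (Finset.mem_range.2
        (hfloor L hL0 n (Finset.mem_filter.1 (Finset.mem_filter.1 hn).1).1 1))]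
  have hsub : ∀ i j, ((S.filter fun n => ⌊(K : ℝ) * u n 0⌋₊ = i).filter
      fun n => ⌊(L : ℝ) * u n 1⌋₊ = j) ⊆ I.filter fun n => ⌊(K : ℝ) * u n 0⌋₊ = i ∧
        ⌊(L : ℝ) * u n 1⌋₊ = j := by
    intro i j n hn
    simp only [S, Finset.mem_filter] at hn ⊢
    tauto
  have hcell : ∀ n ∈ I, ∀ i, ⌊(K : ℝ) * u n 0⌋₊ = i →
      u n 0 ∈ Set.Icc ((i : ℝ) / K) (((i : ℝ) + 1) / K) := fun n hn i hni =>
    Set.Ico_subset_Icc_self ((mem_Ico_div_iff_floor_eq hK0 (h.2.2.1 n hn 0).1 i).2 hni)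
  have hup : ∀ i < K, ∀ j < L, e i j ≤ if (j : ℝ) ≤ L * hi i then 1 else 0 := by
    intro i hi' j hj
    split_ifs with hij
    · exact (Finset.card_le_card (hsub i j)).trans_eq (h.card_filter_floor_eq_one hi' hj)
    · rw [Nat.le_zero, he, Finset.card_eq_zero, Finset.eq_empty_iff_forall_notMem]
      intro n hn
      simp only [S, Finset.mem_filter] at hn
      obtain ⟨⟨⟨hnI, hle⟩, hni⟩, hnj⟩ := hn
      apply hij
      rw [← hnj]
      exact (Nat.floor_le (mul_nonneg hL0'.le (h.2.2.1 n hnI 1).1)).trans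
        (mul_le_mul_of_nonneg_left (hle.trans (hhi i hi' _ (hcell n hnI i hni))) hL0'.le)
  have hdown : ∀ i < K, ∀ j < L, (if (j : ℝ) + 1 ≤ L * lo i then 1 else 0) ≤ e i j := by
    intro i hi' j hj
    split_ifs with hij
    · rw [← h.card_filter_floor_eq_one hi' hj]
      refine Finset.card_le_card fun n hn => ?_
      simp only [S, Finset.mem_filter] at hn ⊢
      obtain ⟨hnI, hni, hnj⟩ := hn
      refine ⟨⟨⟨hnI, le_trans ?_ (hlo i hi' _ (hcell n hnI i hni))⟩, hni⟩, hnj⟩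
      have h2 := Nat.lt_floor_add_one ((L : ℝ) * u n 1)
      rw [hnj] at h2
      exact le_of_mul_le_mul_left (h2.le.trans hij) hL0'
    · exact Nat.zero_le _
  rw [hcard]
  push_cast
  constructor
  · refine Finset.sum_le_sum fun i hi' => ?_
    rw [Finset.mem_range] at hi'
    have h1 := sub_one_le_card_filter_range (L := L) (y := L * lo i)
      (mul_le_of_le_one_right hL0'.le (hlo1 i hi'))
    refine h1.trans ?_
    rw [Finset.card_filter]
    exact_mod_cast Finset.sum_le_sum fun j hj => hdown i hi' j (Finset.mem_range.1 hj)
  · refine Finset.sum_le_sum fun i hi' => ?_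
    rw [Finset.mem_range] at hi'
    have h1 := card_filter_range_le_add_one L (y := L * hi i) (mul_nonneg hL0'.le (hhi0 i hi'))
    refine le_trans ?_ h1
    rw [Finset.card_filter]
    exact_mod_cast Finset.sum_le_sum fun j hj => hup i hi' j (Finset.mem_range.1 hj)

/-- The graph of a monotone function crosses at most `2^d₁ + 2^d₂` cells of the grid, and only these
contribute to the local discrepancy of the region below it. -/
lemma IsNet.abs_card_filter_sub_le {d₁ d₂ : ℕ} {I : Finset ℕ} {u : ℕ → Fin 2 → ℝ}
    (h : IsNet 0 (d₁ + d₂) 2 I u) {ψ : ℝ → ℝ}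
    (hψ : MonotoneOn ψ (Set.Icc 0 1) ∨ AntitoneOn ψ (Set.Icc 0 1))
    (h0 : ∀ x, 0 ≤ ψ x) (h1 : ∀ x, ψ x ≤ 1) :
    |((I.filter fun n => u n 1 ≤ ψ (u n 0)).card : ℝ) - 2 ^ (d₁ + d₂) * ∫ x in (0 : ℝ)..1, ψ x| ≤
      2 ^ d₁ + 2 ^ d₂ := by
  set K := 2 ^ d₁ with hK
  set L := 2 ^ d₂ with hL
  have hK0' : (0 : ℝ) < (K : ℕ) := by rw [hK]; positivity
  have hL0' : (0 : ℝ) < (L : ℕ) := by rw [hL]; positivity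
  have hmem : ∀ i ≤ K, (i : ℝ) / K ∈ Set.Icc (0 : ℝ) 1 := fun i hi =>
    ⟨by positivity, (div_le_one hK0').2 (by exact_mod_cast hi)⟩
  have hsubset : ∀ i < K, Set.Icc ((i : ℝ) / K) (((i : ℝ) + 1) / K) ⊆ Set.Icc 0 1 := by
    intro i hi
    have h2 := (hmem (i + 1) hi).2
    push_cast at h2
    exact Set.Icc_subset_Icc (hmem i hi.le).1 h2
  have hle : ∀ i : ℕ, (i : ℝ) / K ≤ ((i : ℝ) + 1) / K := fun i => by gcongr; linarith
  have hii : IntervalIntegrable ψ volume 0 1 := by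
    rw [← Set.uIcc_of_le zero_le_one] at hψ
    exact hψ.elim MonotoneOn.intervalIntegrable AntitoneOn.intervalIntegrable
  obtain ⟨lo, hi, hlo, hhi, hsum, hlo1, hhi0⟩ : ∃ lo hi : ℕ → ℝ,
      (∀ i < K, ∀ x ∈ Set.Icc ((i : ℝ) / K) (((i : ℝ) + 1) / K), lo i ≤ ψ x) ∧
      (∀ i < K, ∀ x ∈ Set.Icc ((i : ℝ) / K) (((i : ℝ) + 1) / K), ψ x ≤ hi i) ∧
      ∑ i ∈ Finset.range K, (hi i - lo i) ≤ 1 ∧ (∀ i < K, lo i ≤ 1) ∧ (∀ i < K, 0 ≤ hi i) := by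
    have tel := Finset.sum_range_sub (fun i : ℕ => ψ ((i : ℝ) / K)) K
    have tel' := Finset.sum_range_sub' (fun i : ℕ => ψ ((i : ℝ) / K)) K
    push_cast at tel tel'
    rcases hψ with hψ | hψ
    · refine ⟨fun i => ψ ((i : ℝ) / K), fun i => ψ (((i : ℝ) + 1) / K), ?_, ?_, ?_,
        fun i _ => h1 _, fun i _ => h0 _⟩
      · exact fun i hi x hx => hψ (hmem i hi.le) (hsubset i hi hx) hx.1
      · exact fun i hi x hx => hψ (hsubset i hi hx)
          (hsubset i hi (Set.right_mem_Icc.2 (hle i))) hx.2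
      · rw [tel]
        linarith [h1 ((K : ℝ) / K), h0 (0 / K)]
    · refine ⟨fun i => ψ (((i : ℝ) + 1) / K), fun i => ψ ((i : ℝ) / K), ?_, ?_, ?_,
        fun i _ => h1 _, fun i _ => h0 _⟩
      · exact fun i hi x hx => hψ (hsubset i hi hx)
          (hsubset i hi (Set.right_mem_Icc.2 (hle i))) hx.2
      · exact fun i hi x hx => hψ (hmem i hi.le) (hsubset i hi hx) hx.1
      · rw [tel']
        linarith [h0 ((K : ℝ) / K), h1 (0 / K)]
  obtain ⟨hA, hB⟩ := h.card_filter_le_bounds hlo hhi hlo1 hhi0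
  have hint : ∀ i < K, IntervalIntegrable ψ volume ((i : ℝ) / K) (((i + 1 : ℕ) : ℝ) / K) := by
    intro i hi
    refine hii.mono_set ?_
    push_cast
    rw [Set.uIcc_of_le (hle i), Set.uIcc_of_le zero_le_one]
    exact hsubset i hi
  have hsplit : ∫ x in (0 : ℝ)..1, ψ x =
      ∑ i ∈ Finset.range K, ∫ x in ((i : ℝ) / K)..(((i + 1 : ℕ) : ℝ) / K), ψ x := by
    rw [intervalIntegral.sum_integral_adjacent_intervals (a := fun i : ℕ => (i : ℝ) / K) hint]
    simp [hK0'.ne']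
  have hlen : ∀ i : ℕ, ((i : ℝ) + 1) / K - (i : ℝ) / K = (K : ℝ)⁻¹ := fun i => by ring
  have hlow : ∀ i < K, (K : ℝ)⁻¹ * lo i ≤ ∫ x in ((i : ℝ) / K)..(((i + 1 : ℕ) : ℝ) / K), ψ x := by
    intro i hi
    have := hint i hi
    push_cast at this ⊢
    calc (K : ℝ)⁻¹ * lo i = ∫ _ in ((i : ℝ) / K)..(((i : ℝ) + 1) / K), lo i := by
          rw [intervalIntegral.integral_const, hlen, smul_eq_mul]
      _ ≤ _ := intervalIntegral.integral_mono_on (hle i) intervalIntegrable_const this (hlo i hi)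
  have hupp : ∀ i < K, ∫ x in ((i : ℝ) / K)..(((i + 1 : ℕ) : ℝ) / K), ψ x ≤ (K : ℝ)⁻¹ * hi i := by
    intro i hi'
    have := hint i hi'
    push_cast at this ⊢
    calc _ ≤ ∫ _ in ((i : ℝ) / K)..(((i : ℝ) + 1) / K), hi i :=
          intervalIntegral.integral_mono_on (hle i) this intervalIntegrable_const (hhi i hi')
      _ = _ := by rw [intervalIntegral.integral_const, hlen, smul_eq_mul]
  have hI1 : (K : ℝ)⁻¹ * ∑ i ∈ Finset.range K, lo i ≤ ∫ x in (0 : ℝ)..1, ψ x := by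
    rw [hsplit, Finset.mul_sum]
    exact Finset.sum_le_sum fun i hi => hlow i (Finset.mem_range.1 hi)
  have hI2 : ∫ x in (0 : ℝ)..1, ψ x ≤ (K : ℝ)⁻¹ * ∑ i ∈ Finset.range K, hi i := by
    rw [hsplit, Finset.mul_sum]
    exact Finset.sum_le_sum fun i hi => hupp i (Finset.mem_range.1 hi)
  rw [inv_mul_le_iff₀ hK0'] at hI1
  rw [le_inv_mul_iff₀ hK0'] at hI2
  rw [Finset.sum_sub_distrib, ← Finset.mul_sum] at hA
  rw [Finset.sum_add_distrib, ← Finset.mul_sum] at hB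
  simp only [Finset.sum_const, Finset.card_range, nsmul_eq_mul, mul_one] at hA hB
  rw [Finset.sum_sub_distrib] at hsum
  have e1 : (2 : ℝ) ^ (d₁ + d₂) = K * L := by rw [hK, hL]; push_cast; ring
  have e2 : (2 : ℝ) ^ d₁ = K := by rw [hK]; push_cast; ring
  have e3 : (2 : ℝ) ^ d₂ = L := by rw [hL]; push_cast; ring
  rw [e1, e2, e3]
  have g1 := mul_le_mul_of_nonneg_left hI1 hL0'.le
  have g2 := mul_le_mul_of_nonneg_left hI2 hL0'.le
  have g3 := mul_le_mul_of_nonneg_left hsum hL0'.le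
  rw [abs_le]
  constructor <;> nlinarith

lemma IsNet.abs_card_filter_sub_le_sqrt {m : ℕ} {I : Finset ℕ} {u : ℕ → Fin 2 → ℝ}
    (h : IsNet 0 m 2 I u) {ψ : ℝ → ℝ}
    (hψ : MonotoneOn ψ (Set.Icc 0 1) ∨ AntitoneOn ψ (Set.Icc 0 1))
    (h0 : ∀ x, 0 ≤ ψ x) (h1 : ∀ x, ψ x ≤ 1) :
    |((I.filter fun n => u n 1 ≤ ψ (u n 0)).card : ℝ) - 2 ^ m * ∫ x in (0 : ℝ)..1, ψ x| ≤
      3 * √2 ^ m := by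
  have hs : √2 ^ 2 = (2 : ℝ) := Real.sq_sqrt zero_le_two
  have hs1 : 1 ≤ √(2 : ℝ) := Real.one_le_sqrt.2 one_le_two
  obtain ⟨k, rfl | rfl⟩ := m.even_or_odd'
  · rw [two_mul] at h ⊢
    refine (h.abs_card_filter_sub_le hψ h0 h1).trans ?_
    rw [← two_mul, ← two_mul, pow_mul, hs]
    have : (0 : ℝ) < 2 ^ k := by positivity
    linarith
  · rw [show 2 * k + 1 = (k + 1) + k by ring] at h ⊢
    refine (h.abs_card_filter_sub_le hψ h0 h1).trans ?_
    rw [show (k + 1) + k = 2 * k + 1 by ring, pow_succ, pow_succ √2, pow_mul, hs]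
    have : (0 : ℝ) < 2 ^ k := by positivity
    nlinarith

/-- Induction on the binary digits of `q`, from the last one. The subtracted constant `3` leaves room
for the error of the block that an odd digit adds, as `3 (√2 - 1) ≥ 1`. -/
lemma IsDigitalSequence.abs_card_filter_sub_le_aux {u : ℕ → Fin 2 → ℝ}
    (h : IsDigitalSequence 0 2 u) {ψ : ℝ → ℝ}
    (hψ : MonotoneOn ψ (Set.Icc 0 1) ∨ AntitoneOn ψ (Set.Icc 0 1))
    (h0 : ∀ x, 0 ≤ ψ x) (h1 : ∀ x, ψ x ≤ 1) (q : ℕ) (hq : 1 ≤ q) (j : ℕ) :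
    |(((Finset.Icc 1 (2 ^ j * q)).filter fun n => u n 1 ≤ ψ (u n 0)).card : ℝ) -
      (2 ^ j * q : ℕ) * ∫ x in (0 : ℝ)..1, ψ x| ≤ 3 * √2 ^ j * (4 * √q - 3) := by
  have hs : √2 * √2 = (2 : ℝ) := Real.mul_self_sqrt zero_le_two
  have hs1 : 4 / 3 ≤ √(2 : ℝ) := Real.le_sqrt_of_sq_le (by norm_num)
  induction q using Nat.strong_induction_on generalizing j with
  | _ q ih =>
    have hsj : (0 : ℝ) < √2 ^ j := by positivity
    obtain ⟨r, rfl | rfl⟩ := q.even_or_odd'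
    · have hr : 1 ≤ r := by omega
      have := ih r (by omega) hr (j + 1)
      rw [show 2 ^ (j + 1) * r = 2 ^ j * (2 * r) by ring] at this
      refine this.trans ?_
      push_cast
      rw [Real.sqrt_mul zero_le_two, pow_succ]
      nlinarith
    · have hblock := (h (2 * r) j (Nat.zero_le _)).abs_card_filter_sub_le_sqrt hψ h0 h1
      rcases Nat.eq_zero_or_pos r with rfl | hr
      · refine le_trans (le_of_eq ?_) (hblock.trans (le_of_eq ?_))
        · simp
        · norm_num
      · have hprev := ih r (by omega) hr (j + 1)
        have hunion : Finset.Icc 1 (2 ^ j * (2 * r + 1)) =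
            Finset.Icc 1 (2 ^ (j + 1) * r) ∪
              Finset.Icc (2 * r * 2 ^ j + 1) ((2 * r + 1) * 2 ^ j) := by
          ext n
          have e1 : 2 ^ j * (2 * r + 1) = 2 ^ (j + 1) * r + 2 ^ j := by ring
          have e2 : 2 * r * 2 ^ j = 2 ^ (j + 1) * r := by ring
          have e3 : (2 * r + 1) * 2 ^ j = 2 ^ (j + 1) * r + 2 ^ j := by ring
          rw [e1, e2, e3]
          generalize 2 ^ (j + 1) * r = x
          generalize 2 ^ j = y
          simp only [Finset.mem_union, Finset.mem_Icc]
          clear e1 e2 e3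
          omega
        have hdisj : Disjoint (Finset.Icc 1 (2 ^ (j + 1) * r))
            (Finset.Icc (2 * r * 2 ^ j + 1) ((2 * r + 1) * 2 ^ j)) := by
          rw [Finset.disjoint_left]
          intro n hn hn'
          have e2 : 2 * r * 2 ^ j = 2 ^ (j + 1) * r := by ring
          rw [e2] at hn'
          rw [Finset.mem_Icc] at hn hn'
          exact absurd (hn'.1.trans hn.2) (by simp)
        rw [hunion, Finset.filter_union,
          Finset.card_union_of_disjoint (Finset.disjoint_filter_filter hdisj)]
        have hsq : √2 * √r ≤ √((2 * r + 1 : ℕ) : ℝ) := by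
          rw [← Real.sqrt_mul zero_le_two]
          apply Real.sqrt_le_sqrt
          push_cast
          linarith
        have hfin : 3 * √2 ^ (j + 1) * (4 * √r - 3) + 3 * √2 ^ j ≤
            3 * √2 ^ j * (4 * √((2 * r + 1 : ℕ) : ℝ) - 3) := by
          rw [pow_succ]
          nlinarith [mul_le_mul_of_nonneg_left hsq hsj.le, mul_le_mul_of_nonneg_left hs1 hsj.le]
        refine le_trans ?_ ((add_le_add hprev hblock).trans hfin)
        refine le_trans (le_of_eq ?_) (abs_add_le _ _)
        congr 1
        push_cast
        ring

/-- The first `N` points of a `(0,2)`-sequence have discrepancy `O(N^{-1/2})` for the regions under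
graphs of monotone functions: cut `{1, …, N}` into nets along the binary digits of `N` and sum the
geometric series of their errors. -/
lemma IsDigitalSequence.abs_card_filter_sub_le {u : ℕ → Fin 2 → ℝ}
    (h : IsDigitalSequence 0 2 u) {ψ : ℝ → ℝ}
    (hψ : MonotoneOn ψ (Set.Icc 0 1) ∨ AntitoneOn ψ (Set.Icc 0 1))
    (h0 : ∀ x, 0 ≤ ψ x) (h1 : ∀ x, ψ x ≤ 1) {N : ℕ} (hN : 1 ≤ N) :
    |(((Finset.Icc 1 N).filter fun n => u n 1 ≤ ψ (u n 0)).card : ℝ) / N -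
      ∫ x in (0 : ℝ)..1, ψ x| ≤ 12 / √N := by
  have hN0 : (0 : ℝ) < N := by exact_mod_cast hN
  have key := h.abs_card_filter_sub_le_aux hψ h0 h1 N hN 0
  rw [pow_zero, one_mul, pow_zero] at key
  rw [div_sub' hN0.ne', abs_div, abs_of_pos hN0, div_le_div_iff₀ hN0 (by positivity)]
  have h2 : √(N : ℝ) * √N = N := Real.mul_self_sqrt hN0.le
  have h3 : 0 < √(N : ℝ) := by positivity
  calc _ ≤ 12 * √N * √N := by gcongr; linarith
    _ = 12 * N := by rw [mul_assoc, h2]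

/-! ### Generalized inverses of distribution functions -/

lemma quantile_set_nonempty (μ : Measure ℝ) {u : ℝ} (hu : u < 1) :
    {x : ℝ | u ≤ cdf μ x}.Nonempty := by
  obtain ⟨x, hx⟩ := ((tendsto_cdf_atTop μ).eventually (eventually_gt_nhds hu)).exists
  exact ⟨x, hx.le⟩

lemma quantile_set_bddBelow (μ : Measure ℝ) {u : ℝ} (hu : 0 < u) :
    BddBelow {x : ℝ | u ≤ cdf μ x} := by
  obtain ⟨x, hx⟩ := ((tendsto_cdf_atBot μ).eventually (eventually_lt_nhds hu)).exists
  refine ⟨x, fun y hy => ?_⟩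
  by_contra! h
  exact (hy.trans (monotone_cdf μ h.le)).not_gt hx

/-- The quantile function and the distribution function form a Galois connection. -/
lemma quantile_le_iff (μ : Measure ℝ) {u : ℝ} (hu : u ∈ Set.Ioo (0 : ℝ) 1) (a : ℝ) :
    quantile μ u ≤ a ↔ u ≤ cdf μ a := by
  refine ⟨fun h => ?_, fun h => csInf_le (quantile_set_bddBelow μ hu.1) h⟩
  refine le_trans ?_ (monotone_cdf μ h)
  have hc : Tendsto (cdf μ) (𝓝[>] quantile μ u) (𝓝 (cdf μ (quantile μ u))) :=
    ((cdf μ).right_continuous _).mono Set.Ioi_subset_Ici_self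
  refine ge_of_tendsto hc ?_
  filter_upwards [self_mem_nhdsWithin] with x hx
  obtain ⟨y, hy, hyx⟩ := exists_lt_of_csInf_lt (quantile_set_nonempty μ hu.2) hx
  exact le_trans hy (monotone_cdf μ hyx.le)

lemma quantile_monotoneOn (μ : Measure ℝ) : MonotoneOn (quantile μ) (Set.Ioo 0 1) :=
  fun _ hu _ hv huv => (quantile_le_iff μ hu _).2 (huv.trans ((quantile_le_iff μ hv _).1 le_rfl))

/-- Inversion: the quantile function maps the uniform law on `(0, 1)` to the given law. -/
lemma map_quantile (μ : Measure ℝ) [IsProbabilityMeasure μ] :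
    (volume.restrict (Set.Ioo (0 : ℝ) 1)).map (quantile μ) = μ := by
  have hm : AEMeasurable (quantile μ) (volume.restrict (Set.Ioo (0 : ℝ) 1)) :=
    aemeasurable_restrict_of_monotoneOn measurableSet_Ioo (quantile_monotoneOn μ)
  have : IsProbabilityMeasure (volume.restrict (Set.Ioo (0 : ℝ) 1)) := ⟨by simp⟩
  have := Measure.isProbabilityMeasure_map hm
  refine Measure.ext_of_Iic _ _ fun a => ?_
  rw [Measure.map_apply_of_aemeasurable hm measurableSet_Iic]
  have h1 : ∀ᵐ u ∂volume.restrict (Set.Ioo (0 : ℝ) 1),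
      u ∈ quantile μ ⁻¹' Set.Iic a ↔ u ∈ Set.Ioc 0 (cdf μ a) := by
    filter_upwards [ae_restrict_mem measurableSet_Ioo] with u hu
    rw [Set.mem_preimage, Set.mem_Iic, quantile_le_iff μ hu]
    exact ⟨fun h => ⟨hu.1, h⟩, fun h => h.2⟩
  rw [measure_congr (Filter.eventuallyEq_set.2 h1), restrict_Ioo_eq_restrict_Ioc,
    Measure.restrict_apply measurableSet_Ioc,
    Set.inter_eq_left.2 (Set.Ioc_subset_Ioc_right (cdf_le_one μ a)), Real.volume_Ioc, sub_zero,
    cdf_eq_real, ofReal_measureReal]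

lemma integral_comp_quantile (μ : Measure ℝ) [IsProbabilityMeasure μ] {f : ℝ → ℝ}
    (hf : Measurable f) : ∫ u in Set.Ioo (0 : ℝ) 1, f (quantile μ u) = ∫ x, f x ∂μ := by
  conv_rhs => rw [← map_quantile μ]
  rw [integral_map (aemeasurable_restrict_of_monotoneOn measurableSet_Ioo (quantile_monotoneOn μ))
    hf.aestronglyMeasurable]

/-- Quasi-Monte Carlo resampling and mutation: if particles are drawn from `π` by inversion with
the first coordinates, then comparing the second coordinates with a monotone function `h` of the
particles estimates `∫ h dπ` up to `O(N^{-1/2})`, uniformly in `π` and `h`. -/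
lemma IsDigitalSequence.abs_card_quantile_sub_le {u : ℕ → Fin 2 → ℝ}
    (hu : IsDigitalSequence 0 2 u) {N : ℕ} (hN : 1 ≤ N)
    (hu01 : ∀ n, 1 ≤ n → ∀ j, u n j ∈ Set.Ioo (0 : ℝ) 1) (π : Measure ℝ) [IsProbabilityMeasure π]
    {h : ℝ → ℝ} (hh : Monotone h ∨ Antitone h) (h0 : ∀ x, 0 ≤ h x) (h1 : ∀ x, h x ≤ 1) :
    |(((Finset.Icc 1 N).filter fun n => u n 1 ≤ h (quantile π (u n 0))).card : ℝ) / N -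
      ∫ x, h x ∂π| ≤ 12 / √N := by
  have hmeas : Measurable h := hh.elim Monotone.measurable Antitone.measurable
  -- The quantile function is only meaningful on `(0, 1)`, so `h ∘ quantile π` is extended to a
  -- monotone function on `[0, 1]` by extreme values at the end points.
  obtain ⟨ψ, hψ, hψ0, hψ1, heq⟩ : ∃ ψ : ℝ → ℝ,
      (MonotoneOn ψ (Set.Icc 0 1) ∨ AntitoneOn ψ (Set.Icc 0 1)) ∧ (∀ x, 0 ≤ ψ x) ∧
      (∀ x, ψ x ≤ 1) ∧ ∀ x ∈ Set.Ioo (0 : ℝ) 1, ψ x = h (quantile π x) := by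
    rcases hh with hh | hh
    · refine ⟨fun x => if x ≤ 0 then 0 else if 1 ≤ x then 1 else h (quantile π x), .inl ?_,
        fun x => ?_, fun x => ?_, fun x hx => by simp [hx.1.not_ge, hx.2.not_ge]⟩
      · intro x _ y _ hxy
        dsimp only
        split_ifs <;> try first | linarith | exact h0 _ | exact h1 _
        exact hh (quantile_monotoneOn π ⟨not_le.1 ‹¬x ≤ 0›, not_le.1 ‹¬1 ≤ x›⟩
          ⟨not_le.1 ‹¬y ≤ 0›, not_le.1 ‹¬1 ≤ y›⟩ hxy)
      · dsimp only
        split_ifs <;> first | exact h0 _ | norm_num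
      · dsimp only
        split_ifs <;> first | exact h1 _ | norm_num
    · refine ⟨fun x => if x ≤ 0 then 1 else if 1 ≤ x then 0 else h (quantile π x), .inr ?_,
        fun x => ?_, fun x => ?_, fun x hx => by simp [hx.1.not_ge, hx.2.not_ge]⟩
      · intro x _ y _ hxy
        dsimp only
        split_ifs <;> try first | linarith | exact h0 _ | exact h1 _
        exact hh (quantile_monotoneOn π ⟨not_le.1 ‹¬x ≤ 0›, not_le.1 ‹¬1 ≤ x›⟩
          ⟨not_le.1 ‹¬y ≤ 0›, not_le.1 ‹¬1 ≤ y›⟩ hxy)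
      · dsimp only
        split_ifs <;> first | exact h0 _ | norm_num
      · dsimp only
        split_ifs <;> first | exact h1 _ | norm_num
  have key := hu.abs_card_filter_sub_le hψ hψ0 hψ1 hN
  have e1 : ∫ x in (0 : ℝ)..1, ψ x = ∫ x, h x ∂π := by
    rw [intervalIntegral.integral_of_le zero_le_one, integral_Ioc_eq_integral_Ioo,
      ← integral_comp_quantile π hmeas]
    exact setIntegral_congr_fun measurableSet_Ioo heq
  have e2 : ((Finset.Icc 1 N).filter fun n => u n 1 ≤ ψ (u n 0)) =
      (Finset.Icc 1 N).filter fun n => u n 1 ≤ h (quantile π (u n 0)) :=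
    Finset.filter_congr fun n hn => by
      rw [heq _ (hu01 n (Finset.mem_Icc.1 hn).1 0)]
  rwa [e1, e2] at key

/-! ### Empirical and weighted empirical laws -/

lemma lintegral_empirical (N : ℕ) (X : ℕ → ℝ) (f : ℝ → ℝ≥0∞) :
    ∫⁻ x, f x ∂empirical N X = (N : ℝ≥0∞)⁻¹ * ∑ n ∈ Finset.Icc 1 N, f (X n) := by
  rw [empirical, lintegral_smul_measure, lintegral_finsetSum_measure, smul_eq_mul]
  simp_rw [lintegral_dirac]

lemma isProbabilityMeasure_empirical {N : ℕ} (hN : 1 ≤ N) (X : ℕ → ℝ) :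
    IsProbabilityMeasure (empirical N X) := by
  refine ⟨?_⟩
  rw [← setLIntegral_one, Measure.restrict_univ, lintegral_empirical]
  simp only [Finset.sum_const, Nat.card_Icc, Nat.add_sub_cancel, nsmul_eq_mul, mul_one]
  exact ENNReal.inv_mul_cancel (by exact_mod_cast (by omega : N ≠ 0)) (ENNReal.natCast_ne_top N)

lemma cdf_empirical {N : ℕ} (hN : 1 ≤ N) (X : ℕ → ℝ) (a : ℝ) :
    cdf (empirical N X) a = ((Finset.Icc 1 N).filter fun n => X n ≤ a).card / N := by
  have := isProbabilityMeasure_empirical hN X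
  rw [cdf_eq_real, measureReal_def, ← lintegral_indicator_one measurableSet_Iic,
    lintegral_empirical, Finset.card_filter]
  simp only [Set.indicator_apply, Set.mem_Iic, Pi.one_apply]
  rw [ENNReal.toReal_mul, ENNReal.toReal_inv, ENNReal.toReal_natCast, inv_mul_eq_div]
  congr 1
  have : ∑ n ∈ Finset.Icc 1 N, (if X n ≤ a then (1 : ℝ≥0∞) else 0) =
      ((∑ n ∈ Finset.Icc 1 N, if X n ≤ a then 1 else 0 : ℕ) : ℝ≥0∞) := by
    push_cast
    rfl
  rw [this, ENNReal.toReal_natCast]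

/-- Weighting the particles is the same as tilting their empirical law by `G`. -/
lemma weighted_eq_filtering₁ (c : ℝ) {N : ℕ} (hN : 1 ≤ N) (X : ℕ → ℝ) :
    weighted c N X = filtering₁ c (empirical N X) := by
  have hS : 0 < ∑ n ∈ Finset.Icc 1 N, potential c (X n) :=
    Finset.sum_pos (fun n _ => potential_pos c _) (Finset.nonempty_Icc.2 hN)
  have hN0 : (N : ℝ≥0∞) ≠ 0 := by exact_mod_cast (by omega : N ≠ 0)
  ext s hs
  rw [filtering₁, Measure.smul_apply, withDensity_apply _ hs, ← lintegral_indicator hs,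
    lintegral_empirical, lintegral_empirical, smul_eq_mul,
    ENNReal.mul_inv (.inr (ENNReal.sum_ne_top.2 fun _ _ => ENNReal.ofReal_ne_top))
      (.inl (by simpa using hN0)), inv_inv, mul_mul_mul_comm,
    ENNReal.mul_inv_cancel hN0 (ENNReal.natCast_ne_top N), one_mul,
    ← ENNReal.ofReal_sum_of_nonneg fun n _ => (potential_pos c _).le, weighted,
    Measure.finsetSum_apply, Finset.mul_sum]
  refine Finset.sum_congr rfl fun n _ => ?_
  rw [Measure.smul_apply, Measure.dirac_apply' _ hs, smul_eq_mul, ENNReal.ofReal_div_of_pos hS,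
    div_eq_mul_inv]
  by_cases h : X n ∈ s <;> simp [h, mul_comm]

/-! ### The exact filter as an iteration -/

lemma bind_unnormalizedKernel (ρ σ c : ℝ) (μ : Measure ℝ) :
    μ.bind (unnormalizedKernel ρ σ c) =
      (μ.bind (mutation ρ σ)).withDensity fun x => ENNReal.ofReal (potential c x) := by
  have hm : Measurable fun x => ENNReal.ofReal (potential c x) := by fun_prop
  ext s hs
  rw [withDensity_apply _ hs, ← lintegral_indicator hs,
    Measure.lintegral_bind (Kernel.aemeasurable _) (hm.indicator hs).aemeasurable,
    Measure.bind_apply hs (Kernel.aemeasurable _)]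
  congr 1
  ext z
  rw [unnormalizedKernel, Kernel.withDensity_apply' (f := fun _ x => ENNReal.ofReal (potential c x)) _
    (hm.comp measurable_snd), lintegral_indicator hs]

lemma withDensity_potential_eq_smul {c : ℝ} (hc : 0 ≤ c) (μ : Measure ℝ) [IsProbabilityMeasure μ] :
    (μ.withDensity fun x => ENNReal.ofReal (potential c x)) =
      ENNReal.ofReal (∫ x, potential c x ∂μ) • filtering₁ c μ := by
  have h : ENNReal.ofReal (∫ x, potential c x ∂μ) ≠ 0 := by
    simpa using integral_potential_pos hc μ
  rw [filtering₁, smul_smul, lintegral_potential c hc,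
    ENNReal.mul_inv_cancel h ENNReal.ofReal_ne_top, one_smul]

lemma inv_smul_smul_of_isProbabilityMeasure {a : ℝ≥0∞} (h0 : a ≠ 0) (h1 : a ≠ ∞)
    (π : Measure ℝ) [IsProbabilityMeasure π] : ((a • π) Set.univ)⁻¹ • (a • π) = π := by
  rw [Measure.smul_apply, measure_univ, smul_eq_mul, mul_one, smul_smul,
    ENNReal.inv_mul_cancel h0 h1, one_smul]

lemma exists_bind_pow_eq_smul (ρ σ : ℝ) {c : ℝ} (hc : 0 ≤ c) (η₁ : Measure ℝ)
    [IsProbabilityMeasure η₁] (t : ℕ) :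
    ∃ a : ℝ≥0∞, a ≠ 0 ∧ a ≠ ∞ ∧ (filtering₁ c η₁).bind (unnormalizedKernel ρ σ c ^ t) =
      a • filtering₁ c ((predictStep ρ σ c)^[t] η₁) ∧
      IsProbabilityMeasure ((predictStep ρ σ c)^[t] η₁) := by
  induction t with
  | zero =>
    refine ⟨1, one_ne_zero, ENNReal.one_ne_top, ?_, ‹_›⟩
    rw [pow_zero, one_smul]
    exact Measure.id_comp
  | succ t ih =>
    obtain ⟨a, h0, h1, h, hp⟩ := ih
    have hp' := isProbabilityMeasure_predictStep ρ σ hc ((predictStep ρ σ c)^[t] η₁)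
    have hZ : ENNReal.ofReal (∫ x, potential c x ∂predictStep ρ σ c ((predictStep ρ σ c)^[t] η₁)) ≠
        0 := by
      simpa using integral_potential_pos hc _
    refine ⟨a * _, mul_ne_zero h0 hZ, ENNReal.mul_ne_top h1 ENNReal.ofReal_ne_top, ?_, ?_⟩
    · rw [Function.iterate_succ_apply', add_comm t 1, Kernel.pow_add, pow_one,
        ← Measure.comp_assoc, h, Measure.comp_smul, bind_unnormalizedKernel,
        mul_smul, ← withDensity_potential_eq_smul hc]
      rfl
    · rw [Function.iterate_succ_apply']
      exact hp'

lemma isProbabilityMeasure_iterate_predictStep (ρ σ : ℝ) {c : ℝ} (hc : 0 ≤ c) (η₁ : Measure ℝ)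
    [IsProbabilityMeasure η₁] (t : ℕ) : IsProbabilityMeasure ((predictStep ρ σ c)^[t] η₁) := by
  obtain ⟨_, _, _, _, h⟩ := exists_bind_pow_eq_smul ρ σ hc η₁ t
  exact h

lemma filtering_succ (ρ σ : ℝ) {c : ℝ} (hc : 0 ≤ c) (η₁ : Measure ℝ) [IsProbabilityMeasure η₁]
    (t : ℕ) :
    filtering ρ σ c η₁ (t + 1) = filtering₁ c ((predictStep ρ σ c)^[t] η₁) := by
  obtain ⟨a, h0, h1, h, hp⟩ := exists_bind_pow_eq_smul ρ σ hc η₁ t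
  have := isProbabilityMeasure_filtering₁ hc ((predictStep ρ σ c)^[t] η₁)
  rw [filtering, Nat.add_sub_cancel, h, inv_smul_smul_of_isProbabilityMeasure h0 h1]

lemma predictive_succ (ρ σ : ℝ) {c : ℝ} (hc : 0 ≤ c) (η₁ : Measure ℝ) [IsProbabilityMeasure η₁]
    (t : ℕ) : predictive ρ σ c η₁ (t + 1) = (predictStep ρ σ c)^[t] η₁ := by
  cases t with
  | zero => simp [predictive]
  | succ t =>
    rw [predictive, if_neg (by omega), Nat.add_sub_cancel, filtering_succ ρ σ hc,
      Function.iterate_succ_apply', predictStep]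

/-! ### Uniform-in-time propagation of local errors -/

lemma multiStep_iterate_predictStep (ρ σ : ℝ) {c : ℝ} (hc : 0 ≤ c) (η : Measure ℝ)
    [IsProbabilityMeasure η] {f : ℝ → ℝ} {B : ℝ} (hf : Measurable f) (hb : ∀ x, |f x| ≤ B)
    (t k : ℕ) :
    multiStep ρ σ c k ((predictStep ρ σ c)^[t] η) f = multiStep ρ σ c (k + t) η f := by
  induction t generalizing k with
  | zero => rfl
  | succ t ih =>
    have := isProbabilityMeasure_iterate_predictStep ρ σ hc η t
    rw [Function.iterate_succ_apply', multiStep_predictStep ρ σ hc k _ hf hb, ih]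
    congr 1
    omega

lemma multiStep_zero_indicator_Iic (ρ σ c : ℝ) (μ : Measure ℝ) [IsProbabilityMeasure μ] (b : ℝ) :
    multiStep ρ σ c 0 μ ((Set.Iic b).indicator 1) = cdf μ b := by
  rw [multiStep_zero, integral_indicator_Iic]

/-- The exact predictive laws do not lose mass to infinity, as seen by a fixed Gaussian weight. -/
lemma exists_le_integral_potential_iterate (ρ : ℝ) {σ c : ℝ} (hσ : 0 < σ) (hc : 0 < c)
    (η : Measure ℝ) [IsProbabilityMeasure η] :
    ∃ κ : ℝ, 0 < κ ∧ ∀ t,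
      κ ≤ ∫ x, potential (c + ρ ^ 2 / σ ^ 2) x ∂(predictStep ρ σ c)^[t] η := by
  obtain ⟨D, q, hD, hq0, hq1, hr⟩ := exists_stepGain_sq_le ρ hσ hc
  obtain ⟨V, hV, hv⟩ := exists_stepVar_le ρ hσ hc
  set A := c + ρ ^ 2 / σ ^ 2
  have hA : 0 < A := by positivity
  have hI := integral_potential_pos (a := A + A * D) (by positivity) η
  refine ⟨(√(1 + V * A))⁻¹ * ∫ x, potential (A + A * D) x ∂η, by positivity, fun t => ?_⟩
  have := isProbabilityMeasure_iterate_predictStep ρ σ hc.le η t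
  have hab : ∀ x, |potential A x| ≤ 1 := fun x => by
    rw [abs_of_pos (potential_pos A x)]
    exact potential_le_one hA.le x
  rw [← multiStep_zero ρ σ c ((predictStep ρ σ c)^[t] η), multiStep_iterate_predictStep ρ σ hc.le η (measurable_potential A) hab,
    zero_add, multiStep]
  have ha0 := stepPrecision_nonneg ρ σ hc.le t
  have haA := stepPrecision_le ρ hσ hc.le t
  have hrt : stepGain ρ σ c t ^ 2 ≤ D :=
    (hr t).trans (mul_le_of_le_one_right hD.le (pow_le_one₀ hq0.le hq1.le))
  have hvt := hv t
  generalize stepPrecision ρ σ c t = a at *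
  generalize stepGain ρ σ c t = r at *
  generalize stepVar ρ σ c t = v at *
  rw [le_div_iff₀ (integral_potential_pos ha0 η)]
  refine (mul_le_of_le_one_right (by positivity) (integral_potential_le_one ha0 η)).trans ?_
  have hinner : ∀ x, ∫ z, potential A z ∂gaussianReal (r * x) v =
      (√(1 + v * A))⁻¹ * potential (A / (1 + v * A)) (r * x) := by
    intro x
    simpa using integral_potential_mul_gaussianReal hA.le (r * x) v fun _ => 1
  have hin1 : ∀ x, |∫ z, potential A z ∂gaussianReal (r * x) v| ≤ 1 := fun x =>
    abs_integral_le_of_abs_le hab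
  rw [← integral_const_mul]
  refine integral_mono ((integrable_potential (by positivity) η).const_mul _) ?_ fun x => ?_
  · refine integrable_of_abs_le (B := 1)
      ((measurable_potential a).mul (measurable_integral_gaussianReal r v (measurable_potential A)))
      fun x => ?_
    rw [abs_mul, abs_of_pos (potential_pos a x)]
    exact mul_le_one₀ (potential_le_one ha0 x) (abs_nonneg _) (hin1 x)
  · simp only
    rw [hinner, potential_add, mul_left_comm (potential a x)]
    have e1 : (√(1 + V * A))⁻¹ ≤ (√(1 + v * A))⁻¹ := by
      have : (0 : ℝ) < 1 + v * A := by positivity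
      exact inv_anti₀ (by positivity) (Real.sqrt_le_sqrt (by gcongr))
    have e2 : potential (A * D) x ≤ potential (A / (1 + v * A)) (r * x) := by
      rw [potential_mul_right]
      refine potential_le_potential ?_ x
      have h1 : A / (1 + v * A) ≤ A :=
        div_le_self hA.le (le_add_of_nonneg_right (by positivity))
      exact mul_le_mul h1 hrt (sq_nonneg r) hA.le
    have h1 := (potential_pos A x).le
    have h2 := (potential_pos (A * D) x).le
    have h3 := (potential_pos a x).le
    exact mul_le_mul e1 (mul_le_mul (potential_le_potential haA x) e2 h2 h3)
      (mul_nonneg h1 h2) (by positivity)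

lemma exists_abs_integral_potential_sub_le {a : ℝ} (ha : 0 < a) :
    ∃ L : ℝ, 0 < L ∧ ∀ (μ ν : Measure ℝ) [IsProbabilityMeasure μ] [IsProbabilityMeasure ν] (E : ℝ),
      (∀ y, |cdf μ y - cdf ν y| ≤ E) →
        |∫ x, potential a x ∂μ - ∫ x, potential a x ∂ν| ≤ L * E ∧
        ∀ b, |∫ x, potential a x * (Set.Iic b).indicator 1 x ∂μ -
          ∫ x, potential a x * (Set.Iic b).indicator 1 x ∂ν| ≤ L * E := by
  have hgi : Integrable fun x => -(a * x) * potential a x := by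
    refine ((integrable_one_add_sq_mul_potential ha).const_mul a).mono' (by fun_prop)
      (ae_of_all _ fun x => ?_)
    have h2 : |x| ≤ 1 + x ^ 2 := by
      rw [← sq_abs]
      nlinarith [sq_nonneg (|x| - 1), abs_nonneg x]
    rw [Real.norm_eq_abs, abs_mul, abs_neg, abs_mul, abs_of_pos ha, abs_of_pos (potential_pos a x),
      mul_assoc]
    have := (potential_pos a x).le
    gcongr
  have hJ : 0 ≤ ∫ x, |-(a * x) * potential a x| := integral_nonneg fun x => abs_nonneg _
  refine ⟨1 + ∫ x, |-(a * x) * potential a x|, by positivity, fun μ ν _ _ E hE => ?_⟩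
  have hE0 : 0 ≤ E := (abs_nonneg _).trans (hE 0)
  have hi : ∀ (π : Measure ℝ) (b : ℝ), IsProbabilityMeasure π →
      Integrable (fun x => potential a x * (Set.Iic b).indicator 1 x) π := fun π b _ =>
    integrable_of_abs_le (B := 1) ((measurable_potential a).mul (measurable_indicator_Iic b))
      fun x => by
        rw [abs_mul, abs_of_pos (potential_pos a x)]
        exact mul_le_one₀ (potential_le_one ha.le x) (abs_nonneg _) (abs_indicator_Iic_le b x)
  constructor
  · refine (abs_integral_sub_le_of_hasDerivAt μ ν hE (hasDerivAt_potential a) hgi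
      (tendsto_potential_atTop ha)).trans ?_
    rw [mul_comm]
    gcongr
    linarith
  · intro b
    refine (abs_integral_indicator_sub_le_of_hasDerivAt μ ν hE (hasDerivAt_potential a) hgi b
      (hi μ b ‹_›) (hi ν b ‹_›)).trans ?_
    rw [mul_comm, abs_of_pos (potential_pos a b)]
    gcongr
    exact potential_le_one ha.le b

/-- Local errors of size `E` accumulate to a multiple of `E`, as long as the approximating laws
keep a fixed amount of mass near the origin. -/
lemma exists_abs_multiStep_sub_iterate_le (ρ : ℝ) {σ c : ℝ} (hσ : 0 < σ) (hc : 0 < c) {κ : ℝ}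
    (hκ : 0 < κ) :
    ∃ C : ℝ, 0 < C ∧ ∀ (η : Measure ℝ) [IsProbabilityMeasure η] (μ : ℕ → Measure ℝ)
      [∀ t, IsProbabilityMeasure (μ t)] (E : ℝ), (∀ y, |cdf (μ 0) y - cdf η y| ≤ E) →
      (∀ t y, |cdf (μ (t + 1)) y - cdf (predictStep ρ σ c (μ t)) y| ≤ E) →
      ∀ t, κ ≤ ∫ x, potential (c + ρ ^ 2 / σ ^ 2) x ∂η →
        (∀ p ≤ t, κ ≤ ∫ x, potential (c + ρ ^ 2 / σ ^ 2) x ∂μ p) →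
        (∀ p < t, κ ≤ ∫ x, potential (c + ρ ^ 2 / σ ^ 2) x ∂predictStep ρ σ c (μ p)) →
        ∀ k b, |multiStep ρ σ c k (μ t) ((Set.Iic b).indicator 1) -
          multiStep ρ σ c (k + t) η ((Set.Iic b).indicator 1)| ≤ C * E := by
  obtain ⟨C₀, hC₀, hstab⟩ := exists_abs_multiStep_sub_le ρ hσ hc
  obtain ⟨D, q, hD, hq0, hq1, hr⟩ := exists_stepGain_sq_le ρ hσ hc
  set θ := √q
  have hθ0 : 0 < θ := Real.sqrt_pos.2 hq0
  have hθ1 : θ < 1 := by simpa using Real.sqrt_lt_sqrt hq0.le hq1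
  set B := 1 + C₀ * √D / κ ^ 2
  have hB : 0 < B := by positivity
  have hrabs : ∀ k, |stepGain ρ σ c k| ≤ √D * θ ^ k := by
    intro k
    refine abs_le_of_sq_le_sq ?_ (by positivity)
    rw [mul_pow, Real.sq_sqrt hD.le, ← pow_mul, mul_comm k, pow_mul, Real.sq_sqrt hq0.le]
    exact hr k
  have hone : ∀ (μ ν : Measure ℝ) [IsProbabilityMeasure μ] [IsProbabilityMeasure ν] (E : ℝ),
      (∀ y, |cdf μ y - cdf ν y| ≤ E) →
      κ ≤ ∫ x, potential (c + ρ ^ 2 / σ ^ 2) x ∂μ → κ ≤ ∫ x, potential (c + ρ ^ 2 / σ ^ 2) x ∂ν →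
      ∀ k b, |multiStep ρ σ c k μ ((Set.Iic b).indicator 1) -
        multiStep ρ σ c k ν ((Set.Iic b).indicator 1)| ≤ B * θ ^ k * E := by
    intro μ ν _ _ E hE hμ hν k b
    have hE0 : 0 ≤ E := (abs_nonneg _).trans (hE 0)
    cases k with
    | zero =>
      rw [multiStep_zero_indicator_Iic, multiStep_zero_indicator_Iic, pow_zero, mul_one]
      refine (hE b).trans (le_mul_of_one_le_left hE0 ?_)
      exact le_add_of_nonneg_right (by positivity)
    | succ k =>
      calc _ ≤ C₀ * |stepGain ρ σ c (k + 1)| * E / κ ^ 2 := hstab μ ν E κ hE hκ hμ hν k b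
        _ ≤ C₀ * (√D * θ ^ (k + 1)) * E / κ ^ 2 := by gcongr; exact hrabs _
        _ = C₀ * √D / κ ^ 2 * θ ^ (k + 1) * E := by ring
        _ ≤ B * θ ^ (k + 1) * E := by gcongr; exact le_add_of_nonneg_left zero_le_one
  have h1θ : 0 < 1 - θ := sub_pos.2 hθ1
  refine ⟨B * (1 - θ)⁻¹, by positivity, ?_⟩
  intro η _ μ _ E h0 hs t hη hμ hν k b
  have hE0 : 0 ≤ E := (abs_nonneg _).trans (h0 0)
  have key : ∀ s ≤ t, ∀ k, |multiStep ρ σ c k (μ s) ((Set.Iic b).indicator 1) -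
      multiStep ρ σ c (k + s) η ((Set.Iic b).indicator 1)| ≤
        B * E * (θ ^ k * ∑ j ∈ Finset.range (s + 1), θ ^ j) := by
    intro s
    induction s with
    | zero =>
      intro _ k
      refine (hone (μ 0) η E h0 (hμ 0 (Nat.zero_le _)) hη k b).trans (le_of_eq ?_)
      simp
      ring
    | succ s ih =>
      intro hst k
      have hp := isProbabilityMeasure_predictStep ρ σ hc.le (μ s)
      have i1 := hone (μ (s + 1)) (predictStep ρ σ c (μ s)) E (hs s) (hμ (s + 1) hst)
        (hν s hst) k b
      have i2 := ih (by omega) (k + 1)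
      rw [multiStep_predictStep ρ σ hc.le k _ (measurable_indicator_Iic b)
        (abs_indicator_Iic_le b)] at i1
      rw [show k + 1 + s = k + (s + 1) by ring] at i2
      refine (abs_sub_le _ _ _).trans ((add_le_add i1 i2).trans (le_of_eq ?_))
      rw [Finset.sum_range_succ' _ (s + 1)]
      simp_rw [pow_succ]
      rw [← Finset.sum_mul]
      ring
  refine (key t le_rfl k).trans ?_
  have hgeo : ∑ j ∈ Finset.range (t + 1), θ ^ j ≤ (1 - θ)⁻¹ := by
    rw [← tsum_geometric_of_lt_one hθ0.le hθ1]
    exact (summable_geometric_of_lt_one hθ0.le hθ1).sum_le_tsum _ fun _ _ => by positivity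
  calc B * E * (θ ^ k * ∑ j ∈ Finset.range (t + 1), θ ^ j) ≤ B * E * (1 * (1 - θ)⁻¹) := by
        gcongr
        exact pow_le_one₀ hθ0.le hθ1.le
    _ = B * (1 - θ)⁻¹ * E := by ring

/-- Uniform-in-time error bound for any approximate predictive recursion with local Kolmogorov
errors at most `E`. The mass near the origin that stability requires is inherited, by induction on
time, from the exact predictive laws. -/
lemma exists_abs_cdf_sub_iterate_le (ρ : ℝ) {σ c : ℝ} (hσ : 0 < σ) (hc : 0 < c)
    (η : Measure ℝ) [IsProbabilityMeasure η] :
    ∃ C : ℝ, 0 < C ∧ ∀ (μ : ℕ → Measure ℝ)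
      [∀ t, IsProbabilityMeasure (μ t)] (E : ℝ), (∀ y, |cdf (μ 0) y - cdf η y| ≤ E) →
      (∀ t y, |cdf (μ (t + 1)) y - cdf (predictStep ρ σ c (μ t)) y| ≤ E) →
      ∀ t b, |cdf (μ t) b - cdf ((predictStep ρ σ c)^[t] η) b| ≤ C * E := by
  have hA : 0 < c + ρ ^ 2 / σ ^ 2 := by positivity
  obtain ⟨κ₀, hκ₀, hlow⟩ := exists_le_integral_potential_iterate ρ hσ hc η
  obtain ⟨L, hL, hpot⟩ := exists_abs_integral_potential_sub_le hA
  obtain ⟨C, hC, hprop⟩ := exists_abs_multiStep_sub_iterate_le ρ hσ hc (κ := κ₀ / 2) (by positivity)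
  set E₀ := κ₀ / (4 * L * (C + 1)) with hE₀
  have hE₀0 : 0 < E₀ := by positivity
  refine ⟨C + 1 + E₀⁻¹, by positivity, ?_⟩
  intro μ _ E h0 hs
  have hE : 0 ≤ E := (abs_nonneg _).trans (h0 0)
  have hprob := isProbabilityMeasure_iterate_predictStep ρ σ hc.le η
  rcases le_or_gt E E₀ with hle | hgt
  · have hsmall : L * ((C + 1) * E) ≤ κ₀ / 4 := by
      calc L * ((C + 1) * E) ≤ L * ((C + 1) * E₀) := by gcongr
        _ = κ₀ / 4 := by rw [hE₀]; field_simp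
    have hsmall' : L * E ≤ κ₀ / 4 := by
      refine le_trans ?_ hsmall
      gcongr
      exact le_mul_of_one_le_left hE (by linarith)
    suffices key : ∀ t b, |cdf (μ t) b - cdf ((predictStep ρ σ c)^[t] η) b| ≤ (C + 1) * E by
      intro t b
      refine (key t b).trans ?_
      exact mul_le_mul_of_nonneg_right (le_add_of_nonneg_right (by positivity)) hE
    intro t
    induction t using Nat.strong_induction_on with
    | _ t ih =>
      intro b
      cases t with
      | zero => exact (h0 b).trans (le_mul_of_one_le_left hE (by linarith))
      | succ s =>
        have hμ : ∀ p ≤ s, κ₀ * (3 / 4) ≤ ∫ x, potential (c + ρ ^ 2 / σ ^ 2) x ∂μ p := by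
          intro p hp
          have h1 := (hpot (μ p) _ _ (ih p (by omega))).1
          have h2 := hlow p
          linarith [(abs_le.1 h1).1]
        have hν : ∀ p < s, κ₀ / 2 ≤
            ∫ x, potential (c + ρ ^ 2 / σ ^ 2) x ∂predictStep ρ σ c (μ p) := by
          intro p hp
          have := isProbabilityMeasure_predictStep ρ σ hc.le (μ p)
          have h1 := (hpot (μ (p + 1)) _ _ (hs p)).1
          have h2 := hμ (p + 1) hp
          linarith [(abs_le.1 h1).2]
        have hη : κ₀ / 2 ≤ ∫ x, potential (c + ρ ^ 2 / σ ^ 2) x ∂η := by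
          have := hlow 0
          simp only [Function.iterate_zero, id_eq] at this
          linarith
        have i1 := hprop η μ E h0 hs s hη (fun p hp => le_trans (by linarith) (hμ p hp)) hν 1 b
        have := isProbabilityMeasure_predictStep ρ σ hc.le (μ s)
        have hm := measurable_indicator_Iic b
        have hb := abs_indicator_Iic_le b
        rw [show 1 + s = 0 + (s + 1) by ring,
          ← multiStep_iterate_predictStep ρ σ hc.le η hm hb (s + 1) 0, ← zero_add 1,
          ← multiStep_predictStep ρ σ hc.le 0 (μ s) hm hb, multiStep_zero_indicator_Iic,
          zero_add, multiStep_zero_indicator_Iic] at i1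
        exact (abs_sub_le _ _ _).trans ((add_le_add (hs s b) i1).trans (le_of_eq (by ring)))
  -- Large local errors: the Kolmogorov distance never exceeds one.
  · intro t b
    have h1 : |cdf (μ t) b - cdf ((predictStep ρ σ c)^[t] η) b| ≤ 1 :=
      abs_sub_le_iff.2 ⟨by linarith [cdf_le_one (μ t) b, cdf_nonneg ((predictStep ρ σ c)^[t] η) b],
        by linarith [cdf_nonneg (μ t) b, cdf_le_one ((predictStep ρ σ c)^[t] η) b]⟩
    refine h1.trans ?_
    have h2 : 1 ≤ E₀⁻¹ * E := by
      rw [inv_mul_eq_div, one_le_div hE₀0]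
      exact hgt.le
    refine h2.trans ?_
    gcongr
    linarith

lemma cdf_filtering₁ {c : ℝ} (hc : 0 ≤ c) (μ : Measure ℝ) [IsProbabilityMeasure μ] (b : ℝ) :
    cdf (filtering₁ c μ) b =
      (∫ x, potential c x * (Set.Iic b).indicator 1 x ∂μ) / ∫ x, potential c x ∂μ := by
  have := isProbabilityMeasure_filtering₁ hc μ
  rw [← integral_indicator_Iic, integral_filtering₁ hc]

/-- Tilting by `G` is Lipschitz for the Kolmogorov distance near laws with enough mass near the
origin. -/
lemma exists_abs_cdf_filtering₁_sub_le {c : ℝ} (hc : 0 < c) {κ : ℝ} (hκ : 0 < κ) :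
    ∃ C : ℝ, 0 < C ∧ ∀ (μ ν : Measure ℝ) [IsProbabilityMeasure μ] [IsProbabilityMeasure ν] (E : ℝ),
      (∀ y, |cdf μ y - cdf ν y| ≤ E) → κ ≤ ∫ x, potential c x ∂ν →
        ∀ b, |cdf (filtering₁ c μ) b - cdf (filtering₁ c ν) b| ≤ C * E := by
  obtain ⟨L, hL, hpot⟩ := exists_abs_integral_potential_sub_le hc
  refine ⟨2 * L / κ, by positivity, fun μ ν _ _ E hE hν b => ?_⟩
  obtain ⟨h1, h2⟩ := hpot μ ν E hE
  have hB := integral_potential_pos hc.le μ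
  have hB' := integral_potential_pos hc.le ν
  have e : cdf (filtering₁ c μ) b - cdf (filtering₁ c ν) b =
      ((∫ x, potential c x * (Set.Iic b).indicator 1 x ∂μ -
        ∫ x, potential c x * (Set.Iic b).indicator 1 x ∂ν) -
        cdf (filtering₁ c μ) b * (∫ x, potential c x ∂μ - ∫ x, potential c x ∂ν)) /
          ∫ x, potential c x ∂ν := by
    rw [cdf_filtering₁ hc.le, cdf_filtering₁ hc.le]
    field_simp
    ring
  have hE0 : 0 ≤ E := (abs_nonneg _).trans (hE 0)
  rw [e, abs_div, abs_of_pos hB']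
  have h3 : |cdf (filtering₁ c μ) b * (∫ x, potential c x ∂μ - ∫ x, potential c x ∂ν)| ≤ L * E := by
    rw [abs_mul, abs_of_nonneg (cdf_nonneg _ _)]
    exact (mul_le_of_le_one_left (abs_nonneg _) (cdf_le_one _ _)).trans h1
  calc _ ≤ (L * E + L * E) / κ := by
        gcongr
        exact (abs_sub _ _).trans (add_le_add (h2 b) h3)
    _ = _ := by ring

/-! ### Local errors of the particle algorithm -/

lemma monotone_or_antitone_cdf_mutation (ρ σ a : ℝ) :
    Monotone (fun x => cdf (mutation ρ σ x) a) ∨ Antitone fun x => cdf (mutation ρ σ x) a := by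
  have h1 : ∀ x, cdf (mutation ρ σ x) a =
      ∫ z, (Set.Iic a).indicator 1 (ρ * x + z) ∂gaussianReal 0 (σ ^ 2).toNNReal := fun x => by
    rw [← integral_indicator_Iic, ← integral_gaussianReal_eq_zero_mean _ _
      (measurable_indicator_Iic a)]
    rfl
  have h2 : ∀ x y, ρ * x ≤ ρ * y → cdf (mutation ρ σ y) a ≤ cdf (mutation ρ σ x) a := by
    intro x y hxy
    have hi : ∀ m : ℝ, Integrable (fun z => (Set.Iic a).indicator (1 : ℝ → ℝ) (m + z))
        (gaussianReal 0 (σ ^ 2).toNNReal) := fun m =>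
      integrable_of_abs_le ((measurable_indicator_Iic a).comp (measurable_const_add m))
        fun z => abs_indicator_Iic_le a _
    rw [h1, h1]
    refine integral_mono (hi _) (hi _) fun z => ?_
    by_cases hy : ρ * y + z ≤ a
    · have hx : ρ * x + z ≤ a := by linarith
      simp [hx, hy]
    · simp only [Set.indicator_apply, Set.mem_Iic, hy, if_false]
      split_ifs <;> simp
  rcases le_total 0 ρ with hρ | hρ
  · exact .inr fun x y hxy => h2 x y (mul_le_mul_of_nonneg_left hxy hρ)
  · exact .inl fun x y hxy => h2 y x (mul_le_mul_of_nonpos_left hxy hρ)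

lemma cdf_bind_mutation (ρ σ : ℝ) (π : Measure ℝ) [IsProbabilityMeasure π] (a : ℝ) :
    cdf (π.bind (mutation ρ σ)) a = ∫ x, cdf (mutation ρ σ x) a ∂π := by
  rw [← integral_indicator_Iic, integral_bind_mutation ρ σ π (measurable_indicator_Iic a)
    (abs_indicator_Iic_le a)]
  congr 1
  ext x
  rw [← integral_indicator_Iic]
  rfl

lemma abs_cdf_predictiveEst_one_sub_le (ρ σ c : ℝ) (η₁ : Measure ℝ) [IsProbabilityMeasure η₁]
    {N : ℕ} (hN : 1 ≤ N) {u : ℕ → ℕ → Fin 2 → ℝ} (hu : IsDigitalSequence 0 2 (u 1))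
    (hu01 : ∀ n, 1 ≤ n → ∀ j, u 1 n j ∈ Set.Ioo (0 : ℝ) 1) (a : ℝ) :
    |cdf (predictiveEst ρ σ c η₁ N u 1) a - cdf η₁ a| ≤ 12 / √N := by
  have hanti : Antitone ((Set.Iic a).indicator (1 : ℝ → ℝ)) := by
    intro x y hxy
    by_cases hy : y ≤ a
    · simp [hy, hxy.trans hy]
    · simp only [Set.indicator_apply, Set.mem_Iic, hy, if_false]
      split_ifs <;> simp
  have key := hu.abs_card_quantile_sub_le hN hu01 η₁ (h := (Set.Iic a).indicator 1) (.inr hanti)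
    (fun x => Set.indicator_nonneg (fun _ _ => zero_le_one) x)
    (fun x => (abs_le.1 (abs_indicator_Iic_le a x)).2)
  rw [integral_indicator_Iic] at key
  rw [predictiveEst, cdf_empirical hN]
  convert key using 6
  refine Finset.filter_congr fun n hn => ?_
  have h01 := hu01 n (Finset.mem_Icc.1 hn).1 1
  rw [particles]
  by_cases h : quantile η₁ (u 1 n 0) ≤ a
  · simp [h, h01.2.le]
  · simp [h, h01.1]

lemma isProbabilityMeasure_predictiveEst (ρ σ c : ℝ) (η₁ : Measure ℝ) {N : ℕ} (hN : 1 ≤ N)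
    (u : ℕ → ℕ → Fin 2 → ℝ) (t : ℕ) : IsProbabilityMeasure (predictiveEst ρ σ c η₁ N u t) :=
  isProbabilityMeasure_empirical hN _

lemma filteringEst_eq (ρ σ c : ℝ) (η₁ : Measure ℝ) {N : ℕ} (hN : 1 ≤ N)
    (u : ℕ → ℕ → Fin 2 → ℝ) (t : ℕ) :
    filteringEst ρ σ c η₁ N u t = filtering₁ c (predictiveEst ρ σ c η₁ N u t) :=
  weighted_eq_filtering₁ c hN _

/-- A particle lies below `a` exactly when its second coordinate lies under the graph of the
monotone function `x ↦ M(x, (-∞, a])` evaluated at the resampled particle. -/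
lemma abs_cdf_predictiveEst_succ_sub_le (ρ σ : ℝ) {c : ℝ} (hc : 0 ≤ c) (η₁ : Measure ℝ)
    {N : ℕ} (hN : 1 ≤ N) {u : ℕ → ℕ → Fin 2 → ℝ} (t : ℕ)
    (hu : IsDigitalSequence 0 2 (u (t + 2)))
    (hu01 : ∀ n, 1 ≤ n → ∀ j, u (t + 2) n j ∈ Set.Ioo (0 : ℝ) 1) (a : ℝ) :
    |cdf (predictiveEst ρ σ c η₁ N u (t + 2)) a -
      cdf (predictStep ρ σ c (predictiveEst ρ σ c η₁ N u (t + 1))) a| ≤ 12 / √N := by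
  have := isProbabilityMeasure_predictiveEst ρ σ c η₁ hN u (t + 1)
  have := isProbabilityMeasure_filtering₁ hc (predictiveEst ρ σ c η₁ N u (t + 1))
  have key := hu.abs_card_quantile_sub_le hN hu01
    (filtering₁ c (predictiveEst ρ σ c η₁ N u (t + 1)))
    (monotone_or_antitone_cdf_mutation ρ σ a) (fun x => cdf_nonneg _ _) (fun x => cdf_le_one _ _)
  rw [← cdf_bind_mutation] at key
  rw [predictStep, predictiveEst, cdf_empirical hN]
  convert key using 6
  refine Finset.filter_congr fun n hn => ?_
  have h01 := hu01 n (Finset.mem_Icc.1 hn).1 1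
  rw [particles, quantile_le_iff _ h01, weighted_eq_filtering₁ c hN]
  rfl

/-! ### The error bound -/

lemma kolmogorovDist_le {μ ν : Measure ℝ} {E : ℝ} (h : ∀ a, |cdf μ a - cdf ν a| ≤ E) :
    kolmogorovDist μ ν ≤ ENNReal.ofReal E :=
  iSup_le fun a => ENNReal.ofReal_le_ofReal (h a)

/-- Uniformly in time, both errors are of order `N^{-1/2}`, for every choice of `(0,2)`-sequences
in the open square. -/
lemma exists_max_error_le (ρ : ℝ) {σ c : ℝ} (hσ : 0 < σ) (hc : 0 < c)
    (η₁ : Measure ℝ) [IsProbabilityMeasure η₁] :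
    ∃ C : ℝ, 0 < C ∧ ∀ (N : ℕ) (u : ℕ → ℕ → Fin 2 → ℝ), 1 ≤ N →
      (∀ t, 1 ≤ t → IsDigitalSequence 0 2 (u t)) →
      (∀ t, 1 ≤ t → ∀ n, 1 ≤ n → ∀ j, u t n j ∈ Set.Ioo (0 : ℝ) 1) →
      max (filteringError ρ σ c η₁ N u) (predictiveError ρ σ c η₁ N u) ≤
        ENNReal.ofReal (C / √N) := by
  obtain ⟨κ, hκ, hlow⟩ := exists_le_integral_potential_iterate ρ hσ hc η₁
  obtain ⟨C₁, hC₁, hpred⟩ := exists_abs_cdf_sub_iterate_le ρ hσ hc η₁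
  obtain ⟨C₂, hC₂, hfilt⟩ := exists_abs_cdf_filtering₁_sub_le hc hκ
  refine ⟨C₁ * 12 + C₂ * (C₁ * 12), by positivity, fun N u hN hu hu01 => ?_⟩
  have hprob := isProbabilityMeasure_predictiveEst ρ σ c η₁ hN u
  have hprob' := isProbabilityMeasure_iterate_predictStep ρ σ hc.le η₁
  have h1 := hpred (fun t => predictiveEst ρ σ c η₁ N u (t + 1)) (12 / √N)
    (abs_cdf_predictiveEst_one_sub_le ρ σ c η₁ hN (hu 1 le_rfl) (hu01 1 le_rfl))
    (fun t => abs_cdf_predictiveEst_succ_sub_le ρ σ hc.le η₁ hN t (hu _ (by omega))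
      (hu01 _ (by omega)))
  have hκc : ∀ t, κ ≤ ∫ x, potential c x ∂(predictStep ρ σ c)^[t] η₁ := fun t =>
    (hlow t).trans (integral_mono (integrable_potential (by positivity) _)
      (integrable_potential hc.le _)
      (potential_le_potential (le_add_of_nonneg_right (by positivity))))
  have e1 : C₁ * (12 / √N) ≤ (C₁ * 12 + C₂ * (C₁ * 12)) / √N := by
    rw [← mul_div_assoc]
    gcongr
    exact le_add_of_nonneg_right (by positivity)
  have e2 : C₂ * (C₁ * (12 / √N)) ≤ (C₁ * 12 + C₂ * (C₁ * 12)) / √N := by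
    rw [← mul_div_assoc, ← mul_div_assoc]
    gcongr
    exact le_add_of_nonneg_left (by positivity)
  refine max_le (iSup₂_le fun t ht => ?_) (iSup₂_le fun t ht => ?_)
  · obtain ⟨s, rfl⟩ := Nat.exists_eq_add_of_le' ht
    rw [filteringEst_eq ρ σ c η₁ hN, filtering_succ ρ σ hc.le]
    exact kolmogorovDist_le fun a => (hfilt _ _ _ (h1 s) (hκc s) a).trans e2
  · obtain ⟨s, rfl⟩ := Nat.exists_eq_add_of_le' ht
    rw [predictive_succ ρ σ hc.le]
    exact kolmogorovDist_le fun a => (h1 s a).trans e1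

lemma inv_le_delta {N : ℕ} (hN : 1 ≤ N) : (N : ℝ)⁻¹ ≤ delta N := by
  have hN0 : (0 : ℝ) < N := by exact_mod_cast hN
  have hlog : 0 ≤ Real.log N := Real.log_natCast_nonneg N
  have hlog2 : 0 < Real.log 2 := Real.log_pos one_lt_two
  rw [delta]
  split_ifs
  · rw [inv_eq_one_div, div_le_div_iff₀ hN0 (by positivity)]
    nlinarith
  · rw [inv_eq_one_div, div_le_div_iff₀ hN0 (by positivity)]
    have h1 : 0 ≤ Real.log N ^ 2 + 11 * Real.log 2 * Real.log N := by positivity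
    have h2 : 0 < Real.log 2 ^ 2 := by positivity
    nlinarith [mul_nonneg h1 hN0.le, mul_pos h2 hN0]

/-- The rate `δ^{1/2} log(1 + δ^{-1/2})` dominates `N^{-1/2}`: `x log(1 + 1/x) ≥ x / (1 + x)`, which
is increasing in `x`. -/
lemma inv_sqrt_le_rate {N : ℕ} (hN : 1 ≤ N) :
    1 / √(N : ℝ) ≤ 2 * (delta N ^ (1 / 2 : ℝ) *
      Real.log (1 + delta N ^ (-(1 / 2) : ℝ))) := by
  have hN1 : (1 : ℝ) ≤ N := by exact_mod_cast hN
  have hδ := inv_le_delta hN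
  have hδ0 : 0 < delta N := (by positivity : (0 : ℝ) < (N : ℝ)⁻¹).trans_le hδ
  rw [Real.rpow_neg hδ0.le, ← Real.sqrt_eq_rpow]
  set y := √(delta N)
  have hy : 0 < y := Real.sqrt_pos.2 hδ0
  have hw : 1 / √(N : ℝ) ≤ y := by
    rw [one_div, ← Real.sqrt_inv]
    exact Real.sqrt_le_sqrt hδ
  have hw1 : 1 / √(N : ℝ) ≤ 1 := by
    rw [one_div]
    exact inv_le_one_of_one_le₀ (Real.one_le_sqrt.2 hN1)
  have hw0 : 0 ≤ 1 / √(N : ℝ) := by positivity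
  have hl := Real.one_sub_inv_le_log_of_pos (x := 1 + y⁻¹) (by positivity)
  have h1 : y / (1 + y) ≤ y * Real.log (1 + y⁻¹) := by
    calc y / (1 + y) = y * (1 - (1 + y⁻¹)⁻¹) := by field_simp; ring
      _ ≤ _ := by gcongr
  have h2 : 1 / √(N : ℝ) / 2 ≤ y / (1 + y) := by
    rw [div_le_div_iff₀ two_pos (by positivity)]
    nlinarith
  linarith

end SQMC

theorem theorem2 (ρ σ c : ℝ) (hσ : 0 < σ) (hc : 0 < c)
    (η₁ : Measure ℝ) [IsProbabilityMeasure η₁] :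
    ∃ C : ℝ, 0 < C ∧
      ∀ (Ω : Type*) [MeasurableSpace Ω] (P : Measure Ω) [IsProbabilityMeasure P]
        (U : ℕ → ℕ → ℕ → Ω → Fin 2 → ℝ),
        (∀ N t : ℕ, 1 ≤ N → 1 ≤ t → SQMC.IsScrambledSequence P 0 2 (U N t)) →
        (∀ N : ℕ, 1 ≤ N → ∀ᵐ ω ∂P,
          max (SQMC.filteringError ρ σ c η₁ N fun t n => U N t n ω)
              (SQMC.predictiveError ρ σ c η₁ N fun t n => U N t n ω) ≤
            ENNReal.ofReal (C * SQMC.delta N ^ (1 / 2 : ℝ) *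
              Real.log (1 + SQMC.delta N ^ (-(1 / 2) : ℝ)))) ∧
        ∀ᵐ ω ∂P,
          Tendsto (fun N => SQMC.filteringError ρ σ c η₁ N fun t n => U N t n ω) atTop (𝓝 0) ∧
          Tendsto (fun N => SQMC.predictiveError ρ σ c η₁ N fun t n => U N t n ω) atTop (𝓝 0) := by
  obtain ⟨C, hC, hmax⟩ := SQMC.exists_max_error_le ρ hσ hc η₁
  refine ⟨C * 2, by positivity, fun Ω _ P _ U hU => ?_⟩
  have hae : ∀ N : ℕ, 1 ≤ N → ∀ᵐ ω ∂P,
      max (SQMC.filteringError ρ σ c η₁ N fun t n => U N t n ω)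
        (SQMC.predictiveError ρ σ c η₁ N fun t n => U N t n ω) ≤ ENNReal.ofReal (C / √N) := by
    intro N hN
    have h1 : ∀ᵐ ω ∂P, ∀ t, 1 ≤ t → SQMC.IsDigitalSequence 0 2 fun n => U N t n ω :=
      ae_all_iff.2 fun t => eventually_imp_distrib_left.2 fun ht =>
        (hU N t hN ht).isDigitalSequence
    filter_upwards [h1] with ω hω
    exact hmax N _ hN hω fun t ht n hn j => (hU N t hN ht).mem_Ioo n hn ω j
  refine ⟨fun N hN => ?_, ?_⟩
  · filter_upwards [hae N hN] with ω hω
    refine hω.trans (ENNReal.ofReal_le_ofReal ?_)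
    have := mul_le_mul_of_nonneg_left (SQMC.inv_sqrt_le_rate hN) hC.le
    calc C / √N = C * (1 / √N) := by ring
      _ ≤ _ := this
      _ = _ := by ring
  · have hae' : ∀ᵐ ω ∂P, ∀ N : ℕ, 1 ≤ N →
        max (SQMC.filteringError ρ σ c η₁ N fun t n => U N t n ω)
          (SQMC.predictiveError ρ σ c η₁ N fun t n => U N t n ω) ≤ ENNReal.ofReal (C / √N) :=
      ae_all_iff.2 fun N => eventually_imp_distrib_left.2 (hae N)
    have hlim : Tendsto (fun N : ℕ => ENNReal.ofReal (C / √(N : ℝ))) atTop (𝓝 0) := by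
      rw [← ENNReal.ofReal_zero]
      exact ENNReal.tendsto_ofReal (Tendsto.const_div_atTop
        (Real.tendsto_sqrt_atTop.comp tendsto_natCast_atTop_atTop) C)
    filter_upwards [hae'] with ω hω
    constructor
    · refine tendsto_of_tendsto_of_tendsto_of_le_of_le' tendsto_const_nhds hlim
        (Eventually.of_forall fun _ => zero_le) ?_
      filter_upwards [eventually_ge_atTop 1] with N hN
      exact (le_max_left _ _).trans (hω N hN)
    · refine tendsto_of_tendsto_of_tendsto_of_le_of_le' tendsto_const_nhds hlim
        (Eventually.of_forall fun _ => zero_le) ?_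
      filter_upwards [eventually_ge_atTop 1] with N hN
      exact (le_max_right _ _).trans (hω N hN)
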